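/- Let $\mathsf H_1,\mathsf H_0$ be complex Hilbert spaces with $\mathsf H_1\subseteq\mathsf H_0$, the embedding being continuous. Let $A$ be a self-adjoint (possibly unbounded) operator in $\mathsf H_1$, and suppose that $A$ extends to a self-adjoint operator in $\mathsf H_0$ whose domain contains $\mathsf H_1$. Let $\Phi^A(t)$ be the strongly continuous unitary group on $\mathsf H_1$ generated by $-iA$. Let $B:\mathsf H_1\to\mathsf H_1$ be locally Lipschitz, and suppose that there is a map $B'$ from $\mathsf H_1$ to the bounded real-linear operators on $\mathsf H_0$ such that for all $R,\varepsilon>0$ there are $C,\delta>0$ with $$\|B'(u)\|\le C,\qquad \|B(u+w)-B(u)-B'(u)w\|_{\mathsf H_0}\le\varepsilon\|w\|_{\mathsf H_0}$$ for all $u,w\in\mathsf H_1$ with $\|u\|_{\mathsf H_1}\le R$ and $\|w\|_{\mathsf H_1}<\delta$. Let $\alpha,\beta:\mathbb R\to\mathbb R$ be bounded, locally integrable and periodic with a common period $\tau>0$, with $\frac1\tau\int_0^\tau\alpha=\frac1\tau\int_0^\tau\beta=1$. Put $\alpha_n(t)=\alpha(nt)$ and $\beta_n(t)=\beta(nt)$.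 For $u_0\in\mathsf H_1$ let $t\mapsto\Phi(t)u_0$ be the continuous $\mathsf H_1$-valued solution, with maximal existence time $T^*(u_0)$, of $$u(t)=\Phi^A(t)u_0-i\int_0^t\Phi^A(t-s)B(u(s))\,ds,$$ and let $t\mapsto\Phi_n(t)u_0$ be the continuous $\mathsf H_1$-valued solution, with maximal existence time $T_n^*(u_0)$, of $$u_n(t)=\Phi^A\Big(\int_0^t\alpha_n\Big)u_0-i\int_0^t\beta_n(s)\,\Phi^A\Big(\int_s^t\alpha_n\Big)B(u_n(s))\,ds.$$ Let $\theta\in(0,1)$ and let $\mathsf H_\theta=[\mathsf H_0,\mathsf H_1]_\theta$ be the complex interpolation space. Then for all $u_0\in\mathsf H_1$, $0<T<T^*(u_0)$ and $\varepsilon>0$ there is $n_0\in\mathbb N$ such that for every $n\ge n_0$, with $h_n=T/n$, one has $T<T_n^*(u_0)$ and $$\max_{0\le k\le n}\|\Phi(kh_n)u_0-\Phi_n(kh_n)u_0\|_{\mathsf H_\theta}\le\varepsilon\,h_n^{1-\theta}.$$ -/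

import Mathlib

open Set Filter Topology MeasureTheory
open scoped NNReal ENNReal

noncomputable section

/-- `U` is the strongly continuous one-parameter unitary group on `H` with infinitesimal
generator `-iA`: the generator has exactly the domain of `A` and equals `-iA` there. -/
structure IsUnitaryGroupGeneratedBy {H : Type*} [NormedAddCommGroup H] [InnerProductSpace ℂ H]
    (A : H →ₗ.[ℂ] H) (U : ℝ → H →L[ℂ] H) : Prop where
  map_zero : U 0 = ContinuousLinearMap.id ℂ H
  map_add : ∀ s t : ℝ, U (s + t) = (U s).comp (U t)
  norm_map : ∀ (t : ℝ) (x : H), ‖U t x‖ = ‖x‖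
  strongly_continuous : ∀ x : H, Continuous fun t : ℝ => U t x
  generator : ∀ x y : H,
    (x, y) ∈ A.graph ↔ HasDerivAt (fun t : ℝ => U t x) (-(Complex.I • y)) 0

open Classical in
/-- The group `Φ^A`. For self-adjoint `A` there is exactly one group generated by `-iA`
(Stone); the default value is only used for operators without such a group. -/
def unitaryGroup {H : Type*} [NormedAddCommGroup H] [InnerProductSpace ℂ H]
    (A : H →ₗ.[ℂ] H) : ℝ → H →L[ℂ] H :=
  if h : ∃ U : ℝ → H →L[ℂ] H, IsUnitaryGroupGeneratedBy A U then h.choose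
  else fun _ => ContinuousLinearMap.id ℂ H

/-- `u` is a continuous solution on `[0, T]` of the integral form of
`u' + i (α(t) A u + β(t) B(u)) = 0`, `u(0) = u₀`, that is, of
`u(t) = Φ^A(∫₀ᵗ α) u₀ - i ∫₀ᵗ β(s) Φ^A(∫ₛᵗ α) B(u(s)) ds`.
For `α = β = 1` this is the Duhamel equation of `u' + i A u + i B(u) = 0`. -/
structure IsMildSolutionOn {H : Type*} [NormedAddCommGroup H] [InnerProductSpace ℂ H]
    (A : H →ₗ.[ℂ] H) (B : H → H) (α β : ℝ → ℝ) (u₀ : H) (T : ℝ) (u : ℝ → H) : Prop where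
  continuousOn : ContinuousOn u (Icc 0 T)
  duhamel : ∀ t ∈ Icc (0 : ℝ) T,
    u t = unitaryGroup A (∫ r in (0 : ℝ)..t, α r) u₀ -
      Complex.I • ∫ s in (0 : ℝ)..t, β s • unitaryGroup A (∫ r in s..t, α r) (B (u s))

/-- The maximal existence time: the supremum of all `T` such that a solution exists
on `[0, T]`. -/
def existenceTime {H : Type*} [NormedAddCommGroup H] [InnerProductSpace ℂ H]
    (A : H →ₗ.[ℂ] H) (B : H → H) (α β : ℝ → ℝ) (u₀ : H) : ℝ≥0∞ :=
  ⨆ (T : ℝ≥0) (_ : ∃ u : ℝ → H, IsMildSolutionOn A B α β u₀ T u), (T : ℝ≥0∞)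

open Classical in
/-- The flow: the value at time `t` of the solution starting at `u₀` (a junk value if the
solution does not exist up to time `t`). -/
def flow {H : Type*} [NormedAddCommGroup H] [InnerProductSpace ℂ H]
    (A : H →ₗ.[ℂ] H) (B : H → H) (α β : ℝ → ℝ) (t : ℝ) (u₀ : H) : H :=
  if h : ∃ u : ℝ → H, IsMildSolutionOn A B α β u₀ t u then h.choose t else 0

/-- The exact flow `Φ(t) u₀` of `u' + i A u + i B(u) = 0`. -/
def exactFlow {H : Type*} [NormedAddCommGroup H] [InnerProductSpace ℂ H]
    (A : H →ₗ.[ℂ] H) (B : H → H) (t : ℝ) (u₀ : H) : H :=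
  flow A B (fun _ => 1) (fun _ => 1) t u₀

/-- The maximal existence time `T^*(u₀)` of `u' + i A u + i B(u) = 0`. -/
def exactExistenceTime {H : Type*} [NormedAddCommGroup H] [InnerProductSpace ℂ H]
    (A : H →ₗ.[ℂ] H) (B : H → H) (u₀ : H) : ℝ≥0∞ :=
  existenceTime A B (fun _ => 1) (fun _ => 1) u₀

/-- The splitting flow `Φ_n(t) u₀`, with `α_n(t) = α(n t)` and `β_n(t) = β(n t)`. -/
def splittingFlow {H : Type*} [NormedAddCommGroup H] [InnerProductSpace ℂ H]
    (A : H →ₗ.[ℂ] H) (B : H → H) (α β : ℝ → ℝ) (n : ℕ) (t : ℝ) (u₀ : H) : H :=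
  flow A B (fun s => α (n * s)) (fun s => β (n * s)) t u₀

/-- The maximal existence time of the splitting flow `Φ_n(t) u₀`. -/
def splittingExistenceTime {H : Type*} [NormedAddCommGroup H] [InnerProductSpace ℂ H]
    (A : H →ₗ.[ℂ] H) (B : H → H) (α β : ℝ → ℝ) (n : ℕ) (u₀ : H) : ℝ≥0∞ :=
  existenceTime A B (fun s => α (n * s)) (fun s => β (n * s)) u₀

/-- `p` is an admissible time profile: locally integrable, bounded, periodic with period `τ`,
and of mean value one. -/
structure IsSplittingProfile (τ : ℝ) (p : ℝ → ℝ) : Prop where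
  locallyIntegrable : LocallyIntegrable p volume
  bounded : ∃ M : ℝ, ∀ t : ℝ, |p t| ≤ M
  periodic : Function.Periodic p τ
  mean_one : τ⁻¹ * ∫ t in (0 : ℝ)..τ, p t = 1

/-- The pair `(f, g)` belongs to Calderón's function space on the strip `0 ≤ Re z ≤ 1` for the
couple `(H₀, H₁)`, where `H₁` is embedded in `H₀` by `ι`, and has norm at most `M` there.
Since `H₁` is continuously embedded in `H₀`, the sum `H₀ + H₁` is `H₀`, with an equivalent norm.
The function `g` is the boundary value of `f` on `Re z = 1`, as an `H₁`-valued function. -/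
structure IsCalderonFunction {H₀ H₁ : Type*}
    [NormedAddCommGroup H₀] [InnerProductSpace ℂ H₀]
    [NormedAddCommGroup H₁] [InnerProductSpace ℂ H₁]
    (ι : H₁ →L[ℂ] H₀) (f : ℂ → H₀) (g : ℝ → H₁) (M : ℝ) : Prop where
  continuousOn : ContinuousOn f {z : ℂ | 0 ≤ z.re ∧ z.re ≤ 1}
  bounded : ∃ K : ℝ, ∀ z : ℂ, 0 ≤ z.re → z.re ≤ 1 → ‖f z‖ ≤ K
  holomorphic : DifferentiableOn ℂ f {z : ℂ | 0 < z.re ∧ z.re < 1}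
  boundary_one : ∀ t : ℝ, f (1 + t * Complex.I) = ι (g t)
  continuous_one : Continuous g
  tendsto_zero : Tendsto (fun t : ℝ => f (t * Complex.I)) (cocompact ℝ) (𝓝 0)
  tendsto_one : Tendsto g (cocompact ℝ) (𝓝 0)
  norm_zero_le : ∀ t : ℝ, ‖f (t * Complex.I)‖ ≤ M
  norm_one_le : ∀ t : ℝ, ‖g t‖ ≤ M

/-- The norm of the complex interpolation space `[H₀, H₁]_θ`, as an extended norm on `H₀`:
the infimum of the Calderón norms of the `f` with `f(θ) = x`. It is `∞` exactly when `x` does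
not lie in `[H₀, H₁]_θ`. -/
def interpolationENorm {H₀ H₁ : Type*}
    [NormedAddCommGroup H₀] [InnerProductSpace ℂ H₀]
    [NormedAddCommGroup H₁] [InnerProductSpace ℂ H₁]
    (ι : H₁ →L[ℂ] H₀) (θ : ℝ) (x : H₀) : ℝ≥0∞ :=
  ⨅ (M : ℝ≥0) (_ : ∃ (f : ℂ → H₀) (g : ℝ → H₁), IsCalderonFunction ι f g M ∧ f θ = x),
    (M : ℝ≥0∞)

/-- The map `B'` is a derivative of `B` with respect to the norm of `H₀`, uniformly on bounded
subsets of `H₁`. The operators `B'(u)` are bounded and real-linear on `H₀`. -/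
def IsUniformH0Derivative {H₀ H₁ : Type*}
    [NormedAddCommGroup H₀] [InnerProductSpace ℂ H₀]
    [NormedAddCommGroup H₁] [InnerProductSpace ℂ H₁]
    (ι : H₁ →L[ℂ] H₀) (B : H₁ → H₁) (B' : H₁ → H₀ →L[ℝ] H₀) : Prop :=
  ∀ R > (0 : ℝ), ∀ ε > (0 : ℝ), ∃ C > (0 : ℝ), ∃ δ > (0 : ℝ), ∀ u w : H₁, ‖u‖ ≤ R → ‖w‖ < δ →
    ‖B' u‖ ≤ C ∧ ‖ι (B (u + w)) - ι (B u) - B' u (ι w)‖ ≤ ε * ‖ι w‖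

end

/-!
In the interaction picture the splitting differs from the exact evolution only through the time
change `t ↦ ∫₀ᵗ α(n s) ds`, which stays within `O(1/n)` of `t`, and through the factor
`β(n s) - 1`, which has mean zero over each period of length `τ/n`. Inserted into Duhamel's formula
for the exact solution `u`, these produce a consistency error that tends to zero uniformly in `H₁`,
because `u` has compact range and the group is strongly continuous. In `H₀` the error is even
`O(1/n)`: the domain of the extension contains `H₁`, so by Hellinger–Toeplitz `A` is bounded
from `H₁` to `H₀`, and `u`, `B(u)` and the orbits of the group are Lipschitz in time for the norm
of `H₀`. The `H₁` bound lets a Volterra contraction around `u` produce the splitting solution on all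
of `[0, T]`, arbitrarily close to `u`; Grönwall's inequality in `H₀` turns the `O(1/n)` consistency
into an `O(1/n)` error. Finally `‖x‖_θ ≤ e ‖x‖₀^(1-θ) ‖x‖₁^θ` combines an `O(1/n)` and an `o(1)`
into `o(n^(θ-1))`.
-/

noncomputable section

/-! ### Grönwall's inequality and Volterra equations -/

theorem le_mul_exp_of_le_add_integral {f : ℝ → ℝ} {T c K : ℝ} (hK : 0 ≤ K)
    (hf : ContinuousOn f (Icc 0 T))
    (hle : ∀ t ∈ Icc 0 T, f t ≤ c + K * ∫ s in (0 : ℝ)..t, f s) :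
    ∀ t ∈ Icc 0 T, f t ≤ c * Real.exp (K * t) := by
  intro t ht
  have hT : 0 ≤ T := ht.1.trans ht.2
  have hfi : IntervalIntegrable f volume 0 T := (uIcc_of_le hT ▸ hf).intervalIntegrable
  have hcont : ContinuousOn (fun t => c + K * ∫ s in (0 : ℝ)..t, f s) (Icc 0 T) := by
    have := intervalIntegral.continuousOn_primitive_interval' hfi left_mem_uIcc
    exact continuousOn_const.add (continuousOn_const.mul (uIcc_of_le hT ▸ this))
  have hderiv : ∀ x ∈ Ico 0 T,
      HasDerivWithinAt (fun t => c + K * ∫ s in (0 : ℝ)..t, f s) (K * f x) (Ici x) x := by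
    intro x hx
    have hxT : x ∈ Icc 0 T := ⟨hx.1, hx.2.le⟩
    have hIoi : ContinuousWithinAt f (Ioi x) x :=
      ((hf x hxT).mono_of_mem_nhdsWithin (Filter.mem_of_superset (Icc_mem_nhdsGE hx.2)
        (Icc_subset_Icc_left hx.1))).mono Ioi_subset_Ici_self
    have hmeas : StronglyMeasurableAtFilter f (𝓝[>] x) volume :=
      ⟨Icc x T, mem_of_superset (Ioo_mem_nhdsGT hx.2) Ioo_subset_Icc_self,
        (hf.mono (Icc_subset_Icc_left hx.1)).aestronglyMeasurable measurableSet_Icc⟩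
    refine ((intervalIntegral.integral_hasDerivWithinAt_right
      (hfi.mono_set (uIcc_subset_uIcc left_mem_uIcc (uIcc_of_le hT ▸ hxT))) hmeas hIoi).const_mul
      K).const_add c
  have hbound := le_gronwallBound_of_liminf_deriv_right_le (δ := c) (K := K) (ε := 0) hcont
    (fun x hx _ hr => (hderiv x hx).liminf_right_slope_le hr) (by simp)
    (fun x hx => by
      rw [add_zero]
      exact mul_le_mul_of_nonneg_left (hle x ⟨hx.1, hx.2.le⟩) hK) t ht
  rw [gronwallBound_ε0, sub_zero] at hbound
  exact (hle t ht).trans hbound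

section Volterra

variable {E : Type*} [NormedAddCommGroup E] {P : (ℝ → E) → ℝ → E} {T K δ η : ℝ} {u : ℝ → E}

/-- The tube of radius `δ` around the path `u`: the paths which are continuous on `[0, T]` and
stay there within distance `δ` of `u`. -/
def pathTube (u : ℝ → E) (T δ : ℝ) : Set (ℝ → E) :=
  {v | ContinuousOn v (Icc 0 T) ∧ ∀ t ∈ Icc 0 T, ‖v t - u t‖ ≤ δ}

theorem pathTube_mono {δ' : ℝ} (h : δ ≤ δ') : pathTube u T δ ⊆ pathTube u T δ' :=
  fun _ hv => ⟨hv.1, fun t ht => (hv.2 t ht).trans h⟩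

/-- `P` is a Volterra operator with constant `K` on a set `s` of paths on `[0, T]`: it produces
continuous paths, and its Lipschitz constant is that of `K ∫₀ᵗ`. -/
structure IsVolterraOn (P : (ℝ → E) → ℝ → E) (T K : ℝ) (s : Set (ℝ → E)) : Prop where
  continuousOn : ∀ v ∈ s, ContinuousOn (P v) (Icc 0 T)
  norm_sub_le : ∀ v ∈ s, ∀ w ∈ s, ∀ t ∈ Icc 0 T,
    ‖P v t - P w t‖ ≤ K * ∫ r in (0 : ℝ)..t, ‖v r - w r‖

theorem IsVolterraOn.eqOn_of_eqOn {s : Set (ℝ → E)} (hP : IsVolterraOn P T K s) (hK : 0 ≤ K)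
    {v w : ℝ → E} (hv : v ∈ s) (hw : w ∈ s) (hPv : EqOn v (P v) (Icc 0 T))
    (hPw : EqOn w (P w) (Icc 0 T)) : EqOn v w (Icc 0 T) := by
  have hcont : ContinuousOn (fun t => ‖v t - w t‖) (Icc 0 T) :=
    (((hP.continuousOn v hv).congr hPv).sub ((hP.continuousOn w hw).congr hPw)).norm
  refine fun t ht => sub_eq_zero.1 (norm_le_zero_iff.1 ?_)
  simpa using le_mul_exp_of_le_add_integral (c := 0) hK hcont (fun t ht => by
    simpa [← hPv ht, ← hPw ht] using hP.norm_sub_le v hv w hw t ht) t ht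

theorem IsVolterraOn.norm_sub_le_of_exp_weight {s : Set (ℝ → E)} (hP : IsVolterraOn P T K s)
    (hK : 0 < K) {v w : ℝ → E} (hv : v ∈ s) (hw : w ∈ s)
    (hvc : ContinuousOn v (Icc 0 T)) (hwc : ContinuousOn w (Icc 0 T)) {d : ℝ} (hd : 0 ≤ d)
    (hvw : ∀ t ∈ Icc 0 T, ‖v t - w t‖ ≤ Real.exp (2 * K * t) * d) :
    ∀ t ∈ Icc 0 T, ‖P v t - P w t‖ ≤ Real.exp (2 * K * t) * (d / 2) := by
  intro t ht
  have hsub : uIcc 0 t ⊆ Icc 0 T := uIcc_of_le ht.1 ▸ Icc_subset_Icc_right ht.2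
  have hexp : ∫ r in (0 : ℝ)..t, Real.exp (2 * K * r) * d =
      (Real.exp (2 * K * t) - 1) * d / (2 * K) := by
    rw [intervalIntegral.integral_mul_const,
      intervalIntegral.integral_comp_mul_left _ (by positivity), integral_exp, mul_zero,
      Real.exp_zero, smul_eq_mul]
    field_simp
  calc ‖P v t - P w t‖ ≤ K * ∫ r in (0 : ℝ)..t, ‖v r - w r‖ := hP.norm_sub_le v hv w hw t ht
    _ ≤ K * ∫ r in (0 : ℝ)..t, Real.exp (2 * K * r) * d := by
      gcongr
      exact intervalIntegral.integral_mono_on ht.1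
        ((hvc.sub hwc).norm.mono hsub).intervalIntegrable
        (Continuous.intervalIntegrable (by fun_prop) _ _)
        fun r hr => hvw r (hsub (uIcc_of_le ht.1 ▸ hr))
    _ = (Real.exp (2 * K * t) - 1) * (d / 2) := by rw [hexp]; field_simp
    _ ≤ Real.exp (2 * K * t) * (d / 2) := by gcongr; linarith

variable [NormedSpace ℝ E]

/-- The path `t ↦ e^{ct} w(t)` on `[0, T]`, extended continuously to `ℝ`. In terms of these paths,
the usual norm of `C([0, T], E)` becomes the norm `sup e^{-ct} ‖v t‖`. -/
def expWeighted (c : ℝ) (hT : 0 ≤ T) (w : C(Icc 0 T, E)) (t : ℝ) : E :=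
  Real.exp (c * t) • IccExtend hT w t

theorem continuous_expWeighted (c : ℝ) (hT : 0 ≤ T) (w : C(Icc 0 T, E)) :
    Continuous (expWeighted c hT w) := by
  have := w.continuous.Icc_extend' (h := hT)
  unfold expWeighted
  fun_prop

theorem exists_eqOn_expWeighted (c : ℝ) (hT : 0 ≤ T) {v : ℝ → E} (hv : ContinuousOn v (Icc 0 T)) :
    ∃ w : C(Icc 0 T, E), EqOn (expWeighted c hT w) v (Icc 0 T) := by
  refine ⟨⟨fun t => Real.exp (-(c * t)) • v t, ?_⟩, fun t ht => ?_⟩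
  · exact Continuous.smul (by fun_prop) (continuousOn_iff_continuous_domRestrict.1 hv)
  · simp [expWeighted, IccExtend_of_mem hT _ ht, smul_smul, ← Real.exp_add]

theorem dist_le_iff_norm_expWeighted_sub_le (c : ℝ) (hT : 0 ≤ T) {w₁ w₂ : C(Icc 0 T, E)}
    {d : ℝ} (hd : 0 ≤ d) : dist w₁ w₂ ≤ d ↔ ∀ t ∈ Icc 0 T,
      ‖expWeighted c hT w₁ t - expWeighted c hT w₂ t‖ ≤ Real.exp (c * t) * d := by
  rw [ContinuousMap.dist_le hd, Subtype.forall]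
  refine forall₂_congr fun t ht => ?_
  rw [expWeighted, expWeighted, IccExtend_of_mem hT _ ht, IccExtend_of_mem hT _ ht, ← smul_sub,
    norm_smul, Real.norm_eq_abs, Real.abs_exp, mul_le_mul_iff_right₀ (Real.exp_pos _),
    dist_eq_norm]

/- The norm `sup e^{-2Kt} ‖v t‖` turns `P` into a `1/2`-contraction. -/
theorem IsVolterraOn.exists_fixedPoint [CompleteSpace E] (hK : 0 < K) (hT : 0 ≤ T)
    (hP : IsVolterraOn P T K (pathTube u T (Real.exp (2 * K * T) * (2 * η))))
    (hu : ContinuousOn u (Icc 0 T)) (hη : ∀ t ∈ Icc 0 T, ‖P u t - u t‖ ≤ η) :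
    ∃ v ∈ pathTube u T (Real.exp (2 * K * T) * (2 * η)), EqOn v (P v) (Icc 0 T) := by
  have hη0 : 0 ≤ η := (norm_nonneg _).trans (hη 0 ⟨le_rfl, hT⟩)
  obtain ⟨w₀, hw₀⟩ := exists_eqOn_expWeighted (2 * K) hT hu
  have norm_sub_le {w} (hw : w ∈ Metric.closedBall w₀ (2 * η)) {t} (ht : t ∈ Icc 0 T) :
      ‖expWeighted (2 * K) hT w t - u t‖ ≤ Real.exp (2 * K * t) * (2 * η) :=
    hw₀ ht ▸ (dist_le_iff_norm_expWeighted_sub_le (2 * K) hT (by positivity)).1 hw t ht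
  have mem_tube {w} (hw : w ∈ Metric.closedBall w₀ (2 * η)) :
      expWeighted (2 * K) hT w ∈ pathTube u T (Real.exp (2 * K * T) * (2 * η)) :=
    ⟨(continuous_expWeighted _ hT w).continuousOn, fun t ht =>
      (norm_sub_le hw ht).trans (by gcongr; exact ht.2)⟩
  choose! F hF using fun w (hw : w ∈ Metric.closedBall w₀ (2 * η)) =>
    exists_eqOn_expWeighted (2 * K) hT (hP.continuousOn _ (mem_tube hw))
  have u_mem_tube : u ∈ pathTube u T (Real.exp (2 * K * T) * (2 * η)) :=
    ⟨hu, fun _ _ => by rw [sub_self, norm_zero]; positivity⟩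
  have mapsTo : MapsTo F (Metric.closedBall w₀ (2 * η)) (Metric.closedBall w₀ (2 * η)) := by
    refine fun w hw =>
      (dist_le_iff_norm_expWeighted_sub_le (2 * K) hT (by positivity)).2 fun t ht => ?_
    have hPu := hP.norm_sub_le_of_exp_weight hK (mem_tube hw) u_mem_tube
      (mem_tube hw).1 hu (by positivity) (fun s hs => norm_sub_le hw hs) t ht
    have hexp : 1 ≤ Real.exp (2 * K * t) := Real.one_le_exp (mul_nonneg (by positivity) ht.1)
    rw [hF w hw ht, hw₀ ht]
    refine (norm_sub_le_norm_sub_add_norm_sub _ (P u t) _).trans ?_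
    nlinarith [hη t ht]
  have contracting : ContractingWith (1 / 2) (mapsTo.restrict F _ _) := by
    refine ⟨by norm_num, LipschitzWith.of_dist_le_mul fun ⟨w₁, h₁⟩ ⟨w₂, h₂⟩ => ?_⟩
    change dist (F w₁) (F w₂) ≤ ((1 / 2 : ℝ≥0) : ℝ) * dist w₁ w₂
    refine (dist_le_iff_norm_expWeighted_sub_le (2 * K) hT (by positivity)).2 fun t ht => ?_
    rw [hF w₁ h₁ ht, hF w₂ h₂ ht]
    have hw := (dist_le_iff_norm_expWeighted_sub_le (2 * K) hT dist_nonneg).1 (le_refl (dist w₁ w₂))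
    refine (hP.norm_sub_le_of_exp_weight hK (mem_tube h₁) (mem_tube h₂) (mem_tube h₁).1
      (mem_tube h₂).1 dist_nonneg hw t ht).trans_eq ?_
    push_cast
    ring
  obtain ⟨w, hw, hFw, -⟩ := contracting.exists_fixedPoint' Metric.isClosed_closedBall.isComplete
    mapsTo (Metric.mem_closedBall_self (by positivity)) (edist_ne_top _ _)
  exact ⟨_, mem_tube hw, fun t ht => by rw [← hF w hw ht, hFw]⟩

end Volterra

section Averaging

variable {E : Type*} [NormedAddCommGroup E] [NormedSpace ℝ E] {b : ℝ → ℝ} {G : ℝ → E}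
  {σ M K η T : ℝ}

theorem norm_integral_smul_le_of_integral_eq_zero [CompleteSpace E] {x y : ℝ} (hxy : x ≤ y)
    (hM : ∀ t, |b t| ≤ M) (hb : IntervalIntegrable b volume x y) (hb0 : ∫ s in x..y, b s = 0)
    (hG : ContinuousOn G (Icc x y)) (hη : ∀ s ∈ Icc x y, ‖G s - G x‖ ≤ η) :
    ‖∫ s in x..y, b s • G s‖ ≤ M * η * (y - x) := by
  have hcenter : ∫ s in x..y, b s • G s = ∫ s in x..y, b s • (G s - G x) := by
    simp only [smul_sub]
    rw [intervalIntegral.integral_sub (hb.smul_continuousOn (uIcc_of_le hxy ▸ hG))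
      (hb.smul_continuousOn continuousOn_const), intervalIntegral.integral_smul_const, hb0,
      zero_smul, sub_zero]
  rw [hcenter, ← abs_of_nonneg (sub_nonneg.2 hxy)]
  refine intervalIntegral.norm_integral_le_of_norm_le_const fun s hs => ?_
  rw [norm_smul]
  have := (abs_nonneg _).trans (hM s)
  gcongr
  · exact hM s
  · exact hη s (Ioc_subset_Icc_self (uIoc_of_le hxy ▸ hs))

theorem norm_integral_smul_le_of_periods [CompleteSpace E] (hσ : 0 < σ)
    (hb : Function.Periodic b σ) (hM : ∀ t, |b t| ≤ M)
    (hbi : ∀ s t, IntervalIntegrable b volume s t) (hb0 : ∫ s in (0 : ℝ)..σ, b s = 0) (N : ℕ)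
    (hG : ContinuousOn G (Icc 0 (N * σ)))
    (hη : ∀ s ∈ Icc 0 (N * σ), ∀ t ∈ Icc 0 (N * σ), s ≤ t → t ≤ s + σ → ‖G t - G s‖ ≤ η) :
    ‖∫ s in (0 : ℝ)..(N * σ), b s • G s‖ ≤ M * η * (N * σ) := by
  have hsub (k : ℕ) (hk : k < N) :
      Icc (k * σ) ((k + 1 : ℕ) * σ) ⊆ Icc 0 ((N : ℝ) * σ) := by
    refine Icc_subset_Icc (by positivity) ?_
    gcongr
    exact hk
  have hle (k : ℕ) : (k : ℝ) * σ ≤ (k + 1 : ℕ) * σ := by gcongr; simp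
  have hsum := intervalIntegral.sum_integral_adjacent_intervals (μ := volume)
    (f := fun s => b s • G s) (a := fun k : ℕ => (k : ℝ) * σ) (n := N) fun k hk =>
      (hbi _ _).smul_continuousOn (hG.mono (uIcc_of_le (hle k) ▸ hsub k hk))
  simp only [Nat.cast_zero, zero_mul] at hsum
  rw [← hsum]
  refine (norm_sum_le_of_le _ (f := fun k : ℕ => ∫ s in (k * σ)..((k + 1 : ℕ) * σ), b s • G s)
    (n := fun _ => M * η * σ) fun k hk => ?_).trans_eq ?_
  · have hk := Finset.mem_range.1 hk
    have hmean : ∫ s in (k * σ : ℝ)..((k + 1 : ℕ) * σ), b s = 0 := by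
      rw [Nat.cast_succ, add_one_mul, hb.intervalIntegral_add_eq _ 0, zero_add, hb0]
    refine (norm_integral_smul_le_of_integral_eq_zero (η := η) (hle k) hM (hbi _ _) hmean
      (hG.mono (hsub k hk)) fun s hs => ?_).trans_eq (by push_cast; ring)
    exact hη _ (hsub k hk (left_mem_Icc.2 (hle k))) _ (hsub k hk hs) hs.1
      (hs.2.trans_eq (by push_cast; ring))
  · rw [Finset.sum_const, Finset.card_range, nsmul_eq_mul]
    ring

theorem norm_integral_smul_le_of_periodic [CompleteSpace E] (hσ : 0 < σ)
    (hb : Function.Periodic b σ) (hM : ∀ t, |b t| ≤ M)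
    (hbi : ∀ s t, IntervalIntegrable b volume s t) (hb0 : ∫ s in (0 : ℝ)..σ, b s = 0)
    (hT : 0 ≤ T) (hG : ContinuousOn G (Icc 0 T)) (hK : ∀ t ∈ Icc 0 T, ‖G t‖ ≤ K)
    (hη : ∀ s ∈ Icc 0 T, ∀ t ∈ Icc 0 T, s ≤ t → t ≤ s + σ → ‖G t - G s‖ ≤ η) :
    ‖∫ s in (0 : ℝ)..T, b s • G s‖ ≤ M * (T * η + σ * K) := by
  have hM0 : 0 ≤ M := (abs_nonneg _).trans (hM 0)
  have hK0 : 0 ≤ K := (norm_nonneg _).trans (hK 0 ⟨le_rfl, hT⟩)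
  have hη0 : 0 ≤ η := (norm_nonneg _).trans
    (hη 0 ⟨le_rfl, hT⟩ 0 ⟨le_rfl, hT⟩ le_rfl (by linarith))
  set N := ⌊T / σ⌋₊
  have hN_le : N * σ ≤ T := (le_div_iff₀ hσ).1 (Nat.floor_le (div_nonneg hT hσ.le))
  have hT_le : T - N * σ ≤ σ := by
    linarith [(div_le_iff₀ hσ).1 (Nat.lt_floor_add_one (T / σ)).le]
  have hN0 : (0 : ℝ) ≤ N * σ := by positivity
  have hhead : Icc 0 (N * σ) ⊆ Icc 0 T := Icc_subset_Icc_right hN_le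
  have htail : Icc (N * σ) T ⊆ Icc 0 T := Icc_subset_Icc_left hN0
  have hperiods := norm_integral_smul_le_of_periods hσ hb hM hbi hb0 N (hG.mono hhead)
    fun s hs t ht => hη s (hhead hs) t (hhead ht)
  have hremainder : ‖∫ s in (N * σ : ℝ)..T, b s • G s‖ ≤ M * K * |T - N * σ| := by
    refine intervalIntegral.norm_integral_le_of_norm_le_const fun s hs => ?_
    rw [norm_smul]
    gcongr
    · exact hM s
    · exact hK s (htail (Ioc_subset_Icc_self (uIoc_of_le hN_le ▸ hs)))
  rw [abs_of_nonneg (sub_nonneg.2 hN_le)] at hremainder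
  rw [← intervalIntegral.integral_add_adjacent_intervals
    ((hbi _ _).smul_continuousOn (uIcc_of_le hN0 ▸ hG.mono hhead))
    ((hbi _ _).smul_continuousOn (uIcc_of_le hN_le ▸ hG.mono htail))]
  calc _ ≤ M * η * (N * σ) + M * K * (T - N * σ) := norm_add_le_of_le hperiods hremainder
    _ ≤ M * η * T + M * K * σ := by gcongr
    _ = M * (T * η + σ * K) := by ring

end Averaging

section LocallyLipschitz

variable {E F : Type*} [NormedAddCommGroup E] [NormedAddCommGroup F]

/-- `B` is locally Lipschitz for the distance `‖ι x - ι y‖`, where "locally" refers to the topology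
of `E`. -/
def LocallyLipschitzAlong (ι : E → F) (B : E → E) : Prop :=
  ∀ p, ∃ L, ∃ s ∈ 𝓝 p, ∀ x ∈ s, ∀ y ∈ s, ‖ι (B x) - ι (B y)‖ ≤ L * ‖ι x - ι y‖

theorem locallyLipschitzAlong_id {B : E → E} (hB : LocallyLipschitz B) :
    LocallyLipschitzAlong id B := fun p =>
  let ⟨L, s, hs, hL⟩ := hB p
  ⟨L, s, hs, fun _ hx _ hy => hL.norm_sub_le hx hy⟩

theorem LocallyLipschitzAlong.exists_lipschitz_near_isCompact {ι : E → F} {B : E → E}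
    (hB : LocallyLipschitzAlong ι B) {s : Set E} (hs : IsCompact s) :
    ∃ δ > (0 : ℝ), ∃ L > (0 : ℝ), ∀ p ∈ s, ∀ x y, ‖x - p‖ ≤ δ → ‖y - p‖ ≤ δ →
      ‖ι (B x) - ι (B y)‖ ≤ L * ‖ι x - ι y‖ := by
  choose L V hV hL using hB
  choose r hr hrV using fun p => Metric.mem_nhds_iff.1 (hV p)
  obtain ⟨t, -, hst⟩ := hs.elim_nhds_subcover (fun p => Metric.ball p (r p / 2))
    fun p _ => Metric.ball_mem_nhds p (half_pos (hr p))
  have hδ : ∀ᶠ δ in 𝓝[>] (0 : ℝ), ∀ q ∈ t, δ < r q / 2 := t.eventually_all.2 fun q _ =>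
    (gt_mem_nhds (half_pos (hr q))).filter_mono nhdsWithin_le_nhds
  obtain ⟨δ, hδr, hδ⟩ := (hδ.and self_mem_nhdsWithin).exists
  have hL' : ∀ᶠ L' in atTop, ∀ q ∈ t, L q ≤ L' :=
    t.eventually_all.2 fun q _ => eventually_ge_atTop (L q)
  obtain ⟨L', hLL', hL'⟩ := (hL'.and (eventually_gt_atTop 0)).exists
  refine ⟨δ, hδ, L', hL', fun p hp x y hx hy => ?_⟩
  obtain ⟨q, hq, hpq⟩ := mem_iUnion₂.1 (hst hp)
  have mem_V (z : E) (hz : ‖z - p‖ ≤ δ) : z ∈ V q := hrV q <| by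
    rw [Metric.mem_ball] at hpq ⊢
    rw [← dist_eq_norm] at hz
    linarith [dist_triangle z p q, hδr q hq]
  exact (hL q x (mem_V x hx) y (mem_V y hy)).trans (by gcongr; exact hLL' q hq)

end LocallyLipschitz

/-! ### Stone's theorem -/

section Exponential

variable {H : Type*} [NormedAddCommGroup H] [InnerProductSpace ℂ H] [CompleteSpace H]
  {X Y : H →L[ℂ] H}

theorem exp_add_apply_of_commute (h : Commute X Y) (x : H) :
    NormedSpace.exp (X + Y) x = NormedSpace.exp X (NormedSpace.exp Y x) := by
  let +nondep : NormedAlgebra ℚ (H →L[ℂ] H) := .restrictScalars ℚ ℂ (H →L[ℂ] H)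
  exact congrArg (· x) (NormedSpace.exp_add_of_commute h)

theorem exp_add_smul_apply (X : H →L[ℂ] H) (s t : ℝ) (x : H) :
    NormedSpace.exp ((s + t) • X) x = NormedSpace.exp (s • X) (NormedSpace.exp (t • X) x) := by
  rw [add_smul, exp_add_apply_of_commute (((Commute.refl X).smul_left s).smul_right t)]

theorem hasDerivAt_exp_smul_apply (X : H →L[ℂ] H) (x : H) (t : ℝ) :
    HasDerivAt (fun t : ℝ => NormedSpace.exp (t • X) x) (NormedSpace.exp (t • X) (X x)) t :=
  ((ContinuousLinearMap.apply ℂ H x).restrictScalars ℝ).hasFDerivAt.comp_hasDerivAt t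
    (hasDerivAt_exp_smul_const (𝕂 := ℝ) X t)

theorem exp_smul_apply_sub_eq_integral (X : H →L[ℂ] H) (x : H) (t : ℝ) :
    NormedSpace.exp (t • X) x - x = ∫ s in (0 : ℝ)..t, NormedSpace.exp (s • X) (X x) := by
  have hcont : Continuous fun s : ℝ => NormedSpace.exp (s • X) (X x) :=
    continuous_iff_continuousAt.2 fun s => (hasDerivAt_exp_smul_apply X (X x) s).continuousAt
  rw [intervalIntegral.integral_eq_sub_of_hasDerivAt
    (fun s _ => hasDerivAt_exp_smul_apply X x s) (hcont.intervalIntegrable _ _)]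
  simp only [zero_smul, NormedSpace.exp_zero, one_apply_eq_self]

theorem norm_exp_smul_apply_of_mem_skewAdjoint (hX : X ∈ skewAdjoint (H →L[ℂ] H)) (t : ℝ)
    (x : H) : ‖NormedSpace.exp (t • X) x‖ = ‖x‖ := by
  have htX : t • X ∈ skewAdjoint (H →L[ℂ] H) := skewAdjoint.smul_mem t hX
  have hunitary : NormedSpace.exp (t • X) ∈ unitary (H →L[ℂ] H) := by
    let +nondep : NormedAlgebra ℚ (H →L[ℂ] H) := .restrictScalars ℚ ℂ (H →L[ℂ] H)
    exact NormedSpace.exp_mem_unitary_of_mem_skewAdjoint htX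
  exact ContinuousLinearMap.norm_map_of_mem_unitary hunitary x

theorem norm_exp_smul_apply_sub_le (hX : X ∈ skewAdjoint (H →L[ℂ] H)) (t : ℝ) (x : H) :
    ‖NormedSpace.exp (t • X) x - x‖ ≤ |t| * ‖X x‖ := by
  rw [exp_smul_apply_sub_eq_integral, mul_comm]
  simpa using intervalIntegral.norm_integral_le_of_norm_le_const (a := (0 : ℝ)) (b := t)
    fun s _ => (norm_exp_smul_apply_of_mem_skewAdjoint hX s (X x)).le

theorem norm_exp_smul_apply_sub_exp_smul_apply_le (hX : X ∈ skewAdjoint (H →L[ℂ] H))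
    (hY : Y ∈ skewAdjoint (H →L[ℂ] H)) (hXY : Commute X Y) (t : ℝ) (x : H) :
    ‖NormedSpace.exp (t • X) x - NormedSpace.exp (t • Y) x‖ ≤ |t| * ‖X x - Y x‖ := by
  have hsplit : NormedSpace.exp (t • X) x =
      NormedSpace.exp (t • Y) (NormedSpace.exp (t • (X - Y)) x) := by
    rw [← exp_add_apply_of_commute
      (((hXY.symm.sub_right (Commute.refl Y)).smul_left t).smul_right t), ← smul_add,
      add_sub_cancel]
  rw [hsplit, ← map_sub, norm_exp_smul_apply_of_mem_skewAdjoint hY]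
  exact norm_exp_smul_apply_sub_le (sub_mem hX hY) t x

end Exponential

section Graph

variable {H : Type*} [NormedAddCommGroup H] [InnerProductSpace ℂ H] {A : H →ₗ.[ℂ] H}

theorem inner_eq_inner_of_mem_graph (hA : A.IsFormalAdjoint A) {x y a b : H}
    (hx : (x, y) ∈ A.graph) (ha : (a, b) ∈ A.graph) : inner ℂ b x = inner ℂ a y := by
  obtain ⟨x, rfl, rfl⟩ := A.mem_graph_iff.1 hx
  obtain ⟨a, rfl, rfl⟩ := A.mem_graph_iff.1 ha
  exact hA a x

theorem norm_sq_add_smul_of_mem_graph (hA : A.IsFormalAdjoint A) {x y : H}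
    (h : (x, y) ∈ A.graph) (l : ℝ) :
    ‖y + (l * Complex.I) • x‖ ^ 2 = ‖y‖ ^ 2 + l ^ 2 * ‖x‖ ^ 2 := by
  have him : (inner ℂ y x).im = 0 := by
    rw [← Complex.conj_eq_iff_im, inner_conj_symm, inner_eq_inner_of_mem_graph hA h h]
  rw [norm_add_sq (𝕜 := ℂ), norm_smul, inner_smul_right, mul_pow]
  simp [him]

theorem abs_mul_norm_fst_le_of_mem_graph (hA : A.IsFormalAdjoint A) {x y : H}
    (h : (x, y) ∈ A.graph) (l : ℝ) : |l| * ‖x‖ ≤ ‖y + (l * Complex.I) • x‖ := by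
  refine (abs_le_of_sq_le_sq' ?_ (norm_nonneg _)).2
  rw [norm_sq_add_smul_of_mem_graph hA h, mul_pow, sq_abs]
  exact le_add_of_nonneg_left (sq_nonneg _)

theorem norm_snd_le_of_mem_graph (hA : A.IsFormalAdjoint A) {x y : H}
    (h : (x, y) ∈ A.graph) (l : ℝ) : ‖y‖ ≤ ‖y + (l * Complex.I) • x‖ := by
  refine (abs_le_of_sq_le_sq' ?_ (norm_nonneg _)).2
  rw [norm_sq_add_smul_of_mem_graph hA h]
  exact le_add_of_nonneg_right (by positivity)

theorem isFormalAdjoint_of_isSelfAdjoint [CompleteSpace H] (hA : IsSelfAdjoint A) :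
    A.IsFormalAdjoint A := by
  have h := A.adjoint_isFormalAdjoint hA.dense_domain
  rwa [LinearPMap.isSelfAdjoint_def.1 hA] at h

theorem mem_graph_iff_of_isSelfAdjoint [CompleteSpace H] (hA : IsSelfAdjoint A) {x y : H} :
    (x, y) ∈ A.graph ↔ ∀ a b, (a, b) ∈ A.graph → inner ℂ b x = inner ℂ a y := by
  have h := LinearPMap.adjoint_graph_eq_graph_adjoint hA.dense_domain
  rw [LinearPMap.isSelfAdjoint_def.1 hA] at h
  conv_lhs => rw [h]
  simp only [Submodule.mem_adjoint_iff, sub_eq_zero]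

end Graph

section Resolvent

variable {H : Type*} [NormedAddCommGroup H] [InnerProductSpace ℂ H] {A : H →ₗ.[ℂ] H}

/-- The operator `A + i l`, viewed on the graph of `A` as the bounded map `(x, y) ↦ y + i l x`. -/
def graphShift (A : H →ₗ.[ℂ] H) (l : ℝ) : A.graph →L[ℂ] H :=
  (ContinuousLinearMap.snd ℂ H H + ((l : ℂ) * Complex.I) • ContinuousLinearMap.fst ℂ H H).comp
    A.graph.subtypeL

theorem graphShift_apply (l : ℝ) (p : A.graph) :
    graphShift A l p = (p : H × H).2 + (l * Complex.I) • (p : H × H).1 := rfl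

theorem antilipschitzWith_graphShift (hA : A.IsFormalAdjoint A) {l : ℝ} (hl : l ≠ 0) :
    AntilipschitzWith (1 + |l|⁻¹).toNNReal (graphShift A l) := by
  refine (graphShift A l).antilipschitz_of_bound fun ⟨(x, y), h⟩ => ?_
  rw [Real.coe_toNNReal _ (by positivity), graphShift_apply, Submodule.coe_norm, Prod.norm_def,
    add_mul, one_mul]
  have hx := abs_mul_norm_fst_le_of_mem_graph hA h l
  rw [mul_comm, ← le_div_iff₀ (abs_pos.2 hl), div_eq_inv_mul] at hx
  exact max_le (hx.trans (le_add_of_nonneg_left (norm_nonneg _)))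
    ((norm_snd_le_of_mem_graph hA h l).trans (le_add_of_nonneg_right (by positivity)))

theorem isClosed_range_graphShift [CompleteSpace H] (hA : IsSelfAdjoint A) {l : ℝ} (hl : l ≠ 0) :
    IsClosed ((graphShift A l).range : Set H) := by
  have : CompleteSpace A.graph :=
    (show IsClosed (A.graph : Set (H × H)) from hA.isClosed).completeSpace_coe
  have h := (antilipschitzWith_graphShift (isFormalAdjoint_of_isSelfAdjoint hA) hl).isClosed_range
    (graphShift A l).uniformContinuous
  rwa [← (graphShift A l).coe_coe, ← LinearMap.coe_range] at h

theorem range_graphShift [CompleteSpace H] (hA : IsSelfAdjoint A) {l : ℝ} (hl : l ≠ 0) :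
    (graphShift A l).range = ⊤ := by
  have : CompleteSpace (graphShift A l).range :=
    (isClosed_range_graphShift hA hl).completeSpace_coe
  rw [← Submodule.orthogonal_eq_bot_iff, Submodule.eq_bot_iff]
  intro w hw
  have hmem : (w, (l * Complex.I) • w) ∈ A.graph := by
    refine (mem_graph_iff_of_isSelfAdjoint hA).2 fun a b hab => ?_
    have horth : inner ℂ (b + (l * Complex.I) • a) w = 0 := hw _ ⟨⟨(a, b), hab⟩, rfl⟩
    rw [inner_add_left, inner_smul_left, map_mul, Complex.conj_I, Complex.conj_ofReal] at horth
    rw [inner_smul_right]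
    linear_combination horth
  have hle := abs_mul_norm_fst_le_of_mem_graph (isFormalAdjoint_of_isSelfAdjoint hA) hmem (-l)
  rw [Complex.ofReal_neg, neg_mul, neg_smul, add_neg_cancel, norm_zero, abs_neg] at hle
  exact norm_le_zero_iff.1 (nonpos_of_mul_nonpos_right hle (abs_pos.2 hl))

/-- `R` is the resolvent `(A + i l)⁻¹`. -/
structure IsResolvent (A : H →ₗ.[ℂ] H) (l : ℝ) (R : H →L[ℂ] H) : Prop where
  mem_graph : ∀ x, (R x, x - (l * Complex.I) • R x) ∈ A.graph
  apply_add : ∀ x y, (x, y) ∈ A.graph → R (y + (l * Complex.I) • x) = x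

theorem exists_isResolvent [CompleteSpace H] (hA : IsSelfAdjoint A) {l : ℝ} (hl : l ≠ 0) :
    ∃ R, IsResolvent A l R := by
  have : CompleteSpace A.graph :=
    (show IsClosed (A.graph : Set (H × H)) from hA.isClosed).completeSpace_coe
  let e := ContinuousLinearEquiv.ofBijective (graphShift A l)
    (LinearMap.ker_eq_bot.2
      (antilipschitzWith_graphShift (isFormalAdjoint_of_isSelfAdjoint hA) hl).injective)
    (range_graphShift hA hl)
  refine ⟨((ContinuousLinearMap.fst ℂ H H).comp A.graph.subtypeL).comp
    (e.symm : H →L[ℂ] A.graph), fun x => ?_, fun x y hxy => ?_⟩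
  · have hx : (e.symm x : H × H).2 + (l * Complex.I) • (e.symm x : H × H).1 = x :=
      e.apply_symm_apply x
    change ((e.symm x : H × H).1, x - (l * Complex.I) • (e.symm x : H × H).1) ∈ A.graph
    rw [← eq_sub_of_add_eq hx]
    exact (e.symm x).2
  · exact congrArg (fun p : A.graph => (p : H × H).1) (e.symm_apply_apply ⟨(x, y), hxy⟩)

namespace IsResolvent

variable {l m : ℝ} {R S : H →L[ℂ] H}

theorem abs_mul_norm_apply_le (hR : IsResolvent A l R) (hA : A.IsFormalAdjoint A) (x : H) :
    |l| * ‖R x‖ ≤ ‖x‖ := by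
  simpa using abs_mul_norm_fst_le_of_mem_graph hA (hR.mem_graph x) l

theorem smul_apply_sub_eq_neg (hR : IsResolvent A l R) {x y : H} (h : (x, y) ∈ A.graph) :
    (l * Complex.I) • R x - x = -R y := by
  have hx := hR.apply_add x y h
  rw [map_add, map_smul] at hx
  rw [sub_eq_iff_eq_add, ← sub_eq_neg_add]
  exact eq_sub_of_add_eq' hx

theorem apply_add_smul_apply_apply (hR : IsResolvent A l R) (hS : IsResolvent A m S) (x : H) :
    R x + (((l : ℂ) - m) * Complex.I) • R (S x) = S x := by
  rw [← map_smul, ← map_add]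
  convert hR.apply_add _ _ (hS.mem_graph x) using 2
  module

theorem commute (hR : IsResolvent A l R) (hS : IsResolvent A m S) : Commute R S := by
  have hRS := hR.apply_add_smul_apply_apply hS
  have hSR := hS.apply_add_smul_apply_apply hR
  ext x
  change R (S x) = S (R x)
  rcases eq_or_ne l m with rfl | hlm
  · simp only [sub_self, zero_mul, zero_smul, add_zero] at hRS
    simp only [hRS]
  have hne : ((l : ℂ) - m) * Complex.I ≠ 0 :=
    mul_ne_zero (sub_ne_zero.2 (by exact_mod_cast hlm)) Complex.I_ne_zero
  refine smul_right_injective H hne ?_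
  linear_combination (norm := module) hRS x + hSR x

theorem star_eq [CompleteSpace H] (hR : IsResolvent A l R) (hS : IsResolvent A (-l) S)
    (hA : A.IsFormalAdjoint A) : star R = S := by
  rw [ContinuousLinearMap.star_eq_adjoint, eq_comm, ContinuousLinearMap.eq_adjoint_iff]
  intro x y
  have h := inner_eq_inner_of_mem_graph hA (hR.mem_graph y) (hS.mem_graph x)
  simp only [inner_sub_left, inner_sub_right, inner_smul_left, inner_smul_right, map_mul,
    map_neg, Complex.conj_I, Complex.conj_ofReal, Complex.ofReal_neg] at h
  linear_combination -h

end IsResolvent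

end Resolvent

section StrongLimit

theorem tendsto_zero_of_dense {κ 𝕜 E F : Type*} [NontriviallyNormedField 𝕜]
    [NormedAddCommGroup E] [NormedSpace 𝕜 E] [NormedAddCommGroup F] [NormedSpace 𝕜 F]
    {f : Filter κ} {T : κ → E →L[𝕜] F} {C : ℝ} (hC : 0 ≤ C) (hT : ∀ i x, ‖T i x‖ ≤ C * ‖x‖)
    {s : Set E} (hs : Dense s) (h : ∀ x ∈ s, Tendsto (fun i => T i x) f (𝓝 0)) (x : E) :
    Tendsto (fun i => T i x) f (𝓝 0) := by
  rw [Metric.tendsto_nhds]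
  intro ε hε
  obtain ⟨y, hy, hxy⟩ := hs.exists_dist_lt x (ε := ε / (2 * (C + 1))) (by positivity)
  filter_upwards [Metric.tendsto_nhds.1 (h y hy) (ε / 2) (by positivity)] with i hi
  rw [dist_zero_right] at hi ⊢
  rw [dist_eq_norm, lt_div_iff₀ (by positivity)] at hxy
  calc ‖T i x‖ = ‖T i (x - y) + T i y‖ := by rw [map_sub, sub_add_cancel]
    _ ≤ C * ‖x - y‖ + ‖T i y‖ := (norm_add_le _ _).trans (add_le_add_left (hT _ _) _)
    _ < ε := by nlinarith [norm_nonneg (x - y)]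

variable {H : Type*} [NormedAddCommGroup H] [InnerProductSpace ℂ H] [CompleteSpace H]
  {A : H →ₗ.[ℂ] H}

theorem IsResolvent.tendsto_smul_apply {l : ℕ → ℝ} {R : ℕ → H →L[ℂ] H}
    (hR : ∀ n, IsResolvent A (l n) (R n)) (hA : IsSelfAdjoint A)
    (hl : Tendsto (fun n => |l n|) atTop atTop) (x : H) :
    Tendsto (fun n => (l n * Complex.I) • R n x) atTop (𝓝 x) := by
  have hsymm := isFormalAdjoint_of_isSelfAdjoint hA
  have hbound : ∀ n y, ‖(l n * Complex.I) • R n y‖ ≤ ‖y‖ := fun n y => by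
    simpa [norm_smul] using (hR n).abs_mul_norm_apply_le hsymm y
  have hzero := tendsto_zero_of_dense (f := atTop) (C := 2)
    (T := fun n => ((l n : ℂ) * Complex.I) • R n - ContinuousLinearMap.id ℂ H) zero_le_two
    (fun n y => (norm_sub_le _ _).trans (by rw [two_mul]; exact add_le_add_left (hbound n y) _))
    hA.dense_domain (fun y hy => ?_) x
  · simpa using hzero.add_const x
  · have hG := A.mem_graph ⟨y, hy⟩
    refine squeeze_zero_norm' ?_ (hl.const_div_atTop ‖A ⟨y, hy⟩‖)
    filter_upwards [hl.eventually_gt_atTop 0] with n hn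
    change ‖(l n * Complex.I) • R n y - y‖ ≤ _
    rw [(hR n).smul_apply_sub_eq_neg hG, norm_neg, le_div_iff₀ hn, mul_comm]
    exact (hR n).abs_mul_norm_apply_le hsymm _

/-- The approximation `-i A (1 + A² / l²)⁻¹` of `-i A`, where `R` and `S` are the resolvents
`(A + i l)⁻¹` and `(A - i l)⁻¹`. -/
def skewYosida (l : ℝ) (R S : H →L[ℂ] H) : H →L[ℂ] H :=
  (-(Complex.I * (l ^ 2 / 2))) • (R + S)

omit [CompleteSpace H] in
theorem skewYosida_apply {l : ℝ} {R S : H →L[ℂ] H} (hR : IsResolvent A l R)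
    (hS : IsResolvent A (-l) S) {x y : H} (h : (x, y) ∈ A.graph) :
    skewYosida l R S x =
      (-(Complex.I / 2)) • ((l * Complex.I) • R y + (((-l : ℝ) : ℂ) * Complex.I) • S y) := by
  have hRy := hR.smul_apply_sub_eq_neg h
  have hSy := hS.smul_apply_sub_eq_neg h
  rw [← neg_eq_iff_eq_neg] at hRy hSy
  rw [← hRy, ← hSy]
  change (-(Complex.I * (l ^ 2 / 2))) • (R x + S x) = _
  rw [Complex.ofReal_neg]
  match_scalars <;> ring_nf <;> simp only [Complex.I_pow_three] <;> ring

/-- Bounded, commuting, skew-adjoint operators converging strongly to `-i A` on its domain. -/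
structure IsSkewApproximation (A : H →ₗ.[ℂ] H) (X : ℕ → H →L[ℂ] H) : Prop where
  mem_skewAdjoint : ∀ n, X n ∈ skewAdjoint (H →L[ℂ] H)
  commute : ∀ m n, Commute (X m) (X n)
  tendsto_apply : ∀ {x y}, (x, y) ∈ A.graph →
    Tendsto (fun n => X n x) atTop (𝓝 (-(Complex.I • y)))

theorem exists_isSkewApproximation (hA : IsSelfAdjoint A) : ∃ X, IsSkewApproximation A X := by
  have hsymm := isFormalAdjoint_of_isSelfAdjoint hA
  have hne : ∀ n : ℕ, (n + 1 : ℝ) ≠ 0 := fun n => by positivity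
  choose R hR using fun n => exists_isResolvent hA (hne n)
  choose S hS using fun n => exists_isResolvent hA (neg_ne_zero.2 (hne n))
  refine ⟨fun n => skewYosida (n + 1) (R n) (S n), fun n => ?_, fun m n => ?_, fun {x y} h => ?_⟩
  · have hRS := (hR n).star_eq (hS n) hsymm
    rw [skewAdjoint.mem_iff, skewYosida, star_smul, star_add, hRS, ← hRS, star_star,
      ← neg_smul, add_comm (R n)]
    congr 1
    simp
  · exact (((hR m).commute (hR n)).add_right ((hR m).commute (hS n))).add_left
      (((hS m).commute (hR n)).add_right ((hS m).commute (hS n)))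
      |>.smul_right _ |>.smul_left _
  · have hl : Tendsto (fun n : ℕ => |(n + 1 : ℝ)|) atTop atTop := tendsto_abs_atTop_atTop.comp
      (tendsto_atTop_add_const_right _ _ tendsto_natCast_atTop_atTop)
    have hlim := ((IsResolvent.tendsto_smul_apply hR hA hl y).add
      (IsResolvent.tendsto_smul_apply hS hA (by simpa only [abs_neg] using hl) y)).const_smul
        (-(Complex.I / 2))
    rw [show (-(Complex.I / 2)) • (y + y) = -(Complex.I • y) by module] at hlim
    exact hlim.congr fun n => (skewYosida_apply (hR n) (hS n) h).symm

namespace IsSkewApproximation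

variable {X : ℕ → H →L[ℂ] H} {U : ℝ → H →L[ℂ] H}

theorem cauchySeq_exp_smul_apply (hX : IsSkewApproximation A X)
    (hdense : Dense (A.domain : Set H)) (t : ℝ) (x : H) :
    CauchySeq fun n => NormedSpace.exp (t • X n) x := by
  rw [cauchySeq_iff_tendsto_dist_atTop_0]
  have hzero := tendsto_zero_of_dense (f := atTop) (C := 2)
    (T := fun n : ℕ × ℕ => NormedSpace.exp (t • X n.1) - NormedSpace.exp (t • X n.2)) zero_le_two
    (fun n x => ?_) hdense (fun y hy => ?_) x
  · simpa only [dist_eq_norm, sub_apply, norm_zero] using hzero.norm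
  · change ‖NormedSpace.exp (t • X n.1) x - NormedSpace.exp (t • X n.2) x‖ ≤ 2 * ‖x‖
    refine (norm_sub_le _ _).trans_eq ?_
    rw [norm_exp_smul_apply_of_mem_skewAdjoint (hX.mem_skewAdjoint _),
      norm_exp_smul_apply_of_mem_skewAdjoint (hX.mem_skewAdjoint _), two_mul]
  · have hcauchy := cauchySeq_iff_tendsto_dist_atTop_0.1
      (hX.tendsto_apply (A.mem_graph ⟨y, hy⟩)).cauchySeq
    refine squeeze_zero_norm (fun n => ?_) (by simpa using hcauchy.const_mul |t|)
    rw [dist_eq_norm]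
    exact norm_exp_smul_apply_sub_exp_smul_apply_le (hX.mem_skewAdjoint _) (hX.mem_skewAdjoint _)
      (hX.commute _ _) t y

theorem exists_tendsto_exp_smul_apply (hX : IsSkewApproximation A X)
    (hdense : Dense (A.domain : Set H)) :
    ∃ U : ℝ → H →L[ℂ] H, ∀ t x, Tendsto (fun n => NormedSpace.exp (t • X n) x) atTop
      (𝓝 (U t x)) := by
  choose f hf using fun t x => cauchySeq_tendsto_of_complete
    (hX.cauchySeq_exp_smul_apply hdense t x)
  exact ⟨fun t => continuousLinearMapOfTendsto (fun n => NormedSpace.exp (t • X n))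
    (tendsto_pi_nhds.2 (hf t)), hf⟩

theorem norm_limit_apply (hX : IsSkewApproximation A X)
    (hU : ∀ t x, Tendsto (fun n => NormedSpace.exp (t • X n) x) atTop (𝓝 (U t x)))
    (t : ℝ) (x : H) : ‖U t x‖ = ‖x‖ := by
  refine tendsto_nhds_unique (hU t x).norm ?_
  simp only [norm_exp_smul_apply_of_mem_skewAdjoint (hX.mem_skewAdjoint _)]
  exact tendsto_const_nhds

theorem tendsto_exp_smul_apply_of_tendsto (hX : IsSkewApproximation A X)
    (hU : ∀ t x, Tendsto (fun n => NormedSpace.exp (t • X n) x) atTop (𝓝 (U t x)))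
    (t : ℝ) {z : ℕ → H} {x : H} (hz : Tendsto z atTop (𝓝 x)) :
    Tendsto (fun n => NormedSpace.exp (t • X n) (z n)) atTop (𝓝 (U t x)) := by
  have hdiff : Tendsto (fun n => NormedSpace.exp (t • X n) (z n - x)) atTop (𝓝 0) := by
    rw [tendsto_zero_iff_norm_tendsto_zero]
    simp only [norm_exp_smul_apply_of_mem_skewAdjoint (hX.mem_skewAdjoint _)]
    exact tendsto_iff_norm_sub_tendsto_zero.1 hz
  simpa only [map_sub, sub_add_cancel, zero_add] using hdiff.add (hU t x)

theorem limit_zero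
    (hU : ∀ t x, Tendsto (fun n => NormedSpace.exp (t • X n) x) atTop (𝓝 (U t x))) :
    U 0 = ContinuousLinearMap.id ℂ H := by
  ext x
  refine tendsto_nhds_unique (hU 0 x) ?_
  simp only [zero_smul, NormedSpace.exp_zero, one_apply_eq_self]
  exact tendsto_const_nhds

theorem limit_add (hX : IsSkewApproximation A X)
    (hU : ∀ t x, Tendsto (fun n => NormedSpace.exp (t • X n) x) atTop (𝓝 (U t x)))
    (s t : ℝ) : U (s + t) = (U s).comp (U t) := by
  ext x
  refine tendsto_nhds_unique (hU (s + t) x) ?_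
  simp only [exp_add_smul_apply]
  exact hX.tendsto_exp_smul_apply_of_tendsto hU s (hU t x)

theorem norm_limit_apply_sub_le (hX : IsSkewApproximation A X)
    (hU : ∀ t x, Tendsto (fun n => NormedSpace.exp (t • X n) x) atTop (𝓝 (U t x)))
    {x y : H} (h : (x, y) ∈ A.graph) (t : ℝ) : ‖U t x - x‖ ≤ |t| * ‖y‖ := by
  have hle := (hX.tendsto_apply h).norm.const_mul |t|
  rw [norm_neg, norm_smul, Complex.norm_I, one_mul] at hle
  exact le_of_tendsto_of_tendsto' ((hU t x).sub_const x).norm hle fun n =>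
    norm_exp_smul_apply_sub_le (hX.mem_skewAdjoint n) t x

theorem continuous_limit_apply (hX : IsSkewApproximation A X)
    (hdense : Dense (A.domain : Set H))
    (hU : ∀ t x, Tendsto (fun n => NormedSpace.exp (t • X n) x) atTop (𝓝 (U t x))) (x : H) :
    Continuous fun t => U t x := by
  refine continuous_of_uniform_approx_of_continuous fun u hu => ?_
  obtain ⟨ε, hε, hεu⟩ := Metric.mem_uniformity_dist.1 hu
  obtain ⟨y, hy, hxy⟩ := hdense.exists_dist_lt x hε
  refine ⟨fun t => U t y, ?_, fun t => hεu ?_⟩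
  · refine (LipschitzWith.of_dist_le_mul (K := ‖A ⟨y, hy⟩‖₊) fun s t => ?_).continuous
    have hst : U s y - U t y = U t (U (s - t) y - y) := by
      rw [map_sub, ← ContinuousLinearMap.comp_apply, ← hX.limit_add hU, add_sub_cancel]
    rw [dist_eq_norm, hst, hX.norm_limit_apply hU, mul_comm, Real.dist_eq]
    exact hX.norm_limit_apply_sub_le hU (A.mem_graph ⟨y, hy⟩) _
  · rwa [dist_eq_norm, ← map_sub, hX.norm_limit_apply hU, ← dist_eq_norm]

theorem limit_apply_sub_eq_integral (hX : IsSkewApproximation A X)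
    (hU : ∀ t x, Tendsto (fun n => NormedSpace.exp (t • X n) x) atTop (𝓝 (U t x)))
    {x y : H} (h : (x, y) ∈ A.graph) (t : ℝ) :
    U t x - x = ∫ s in (0 : ℝ)..t, U s (-(Complex.I • y)) := by
  refine tendsto_nhds_unique ((hU t x).sub_const x) ?_
  simp only [exp_smul_apply_sub_eq_integral]
  refine intervalIntegral.tendsto_integral_filter_of_dominated_convergence (fun _ => ‖y‖ + 1)
    (Eventually.of_forall fun n => ?_) ?_ intervalIntegrable_const
    (ae_of_all _ fun s _ => hX.tendsto_exp_smul_apply_of_tendsto hU s (hX.tendsto_apply h))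
  · exact (continuous_iff_continuousAt.2 fun s =>
      (hasDerivAt_exp_smul_apply (X n) (X n x) s).continuousAt).aestronglyMeasurable
  · have hnorm := (hX.tendsto_apply h).norm
    rw [norm_neg, norm_smul, Complex.norm_I, one_mul] at hnorm
    filter_upwards [hnorm.eventually_le_const (lt_add_one ‖y‖)] with n hn
    exact ae_of_all _ fun s _ =>
      (norm_exp_smul_apply_of_mem_skewAdjoint (hX.mem_skewAdjoint n) s _).trans_le hn

theorem hasDerivAt_limit_apply (hX : IsSkewApproximation A X)
    (hdense : Dense (A.domain : Set H))
    (hU : ∀ t x, Tendsto (fun n => NormedSpace.exp (t • X n) x) atTop (𝓝 (U t x)))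
    {x y : H} (h : (x, y) ∈ A.graph) :
    HasDerivAt (fun t => U t x) (-(Complex.I • y)) 0 := by
  have hcont := hX.continuous_limit_apply hdense hU (-(Complex.I • y))
  have hderiv := (intervalIntegral.integral_hasDerivAt_right (hcont.intervalIntegrable 0 0)
    hcont.stronglyMeasurable.stronglyMeasurableAtFilter hcont.continuousAt).const_add x
  simp only [← hX.limit_apply_sub_eq_integral hU h, add_sub_cancel] at hderiv
  rwa [limit_zero hU] at hderiv

end IsSkewApproximation

theorem mem_graph_of_hasDerivAt (hA : IsSelfAdjoint A) {U : ℝ → H →L[ℂ] H}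
    (h0 : U 0 = ContinuousLinearMap.id ℂ H) (hnorm : ∀ t x, ‖U t x‖ = ‖x‖)
    (hderiv : ∀ a b, (a, b) ∈ A.graph → HasDerivAt (fun t => U t a) (-(Complex.I • b)) 0)
    {x y : H} (h : HasDerivAt (fun t => U t x) (-(Complex.I • y)) 0) : (x, y) ∈ A.graph := by
  refine (mem_graph_iff_of_isSelfAdjoint hA).2 fun a b hab => ?_
  have hconst : (fun t => inner ℂ (U t a) (U t x)) = fun _ => inner ℂ a x := funext fun t =>
    (⟨(U t).toLinearMap, hnorm t⟩ : H →ₗᵢ[ℂ] H).inner_map_map a x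
  have hinner := HasDerivAt.inner ℂ (hderiv a b hab) h
  rw [hconst] at hinner
  have hzero := hinner.unique (hasDerivAt_const _ _)
  simp only [h0, ContinuousLinearMap.id_apply, inner_neg_right, inner_neg_left,
    inner_smul_right, inner_smul_left, Complex.conj_I] at hzero
  refine sub_eq_zero.1 ((mul_eq_zero.1 ?_).resolve_left Complex.I_ne_zero)
  linear_combination hzero

theorem exists_isUnitaryGroupGeneratedBy (hA : IsSelfAdjoint A) :
    ∃ U, IsUnitaryGroupGeneratedBy A U := by
  obtain ⟨X, hX⟩ := exists_isSkewApproximation hA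
  obtain ⟨U, hU⟩ := hX.exists_tendsto_exp_smul_apply hA.dense_domain
  have h0 := IsSkewApproximation.limit_zero hU
  have hnorm := hX.norm_limit_apply hU
  have hderiv : ∀ x y, (x, y) ∈ A.graph → HasDerivAt (fun t => U t x) (-(Complex.I • y)) 0 :=
    fun _ _ => hX.hasDerivAt_limit_apply hA.dense_domain hU
  exact ⟨U, h0, hX.limit_add hU, hnorm, hX.continuous_limit_apply hA.dense_domain hU,
    fun x y => ⟨hderiv x y, mem_graph_of_hasDerivAt hA h0 hnorm hderiv⟩⟩

theorem isUnitaryGroupGeneratedBy_unitaryGroup (hA : IsSelfAdjoint A) :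
    IsUnitaryGroupGeneratedBy A (unitaryGroup A) := by
  rw [unitaryGroup, dif_pos (exists_isUnitaryGroupGeneratedBy hA)]
  exact (exists_isUnitaryGroupGeneratedBy hA).choose_spec

end StrongLimit

/-! ### Unitary groups and Duhamel's formula -/

section NormMapIntegral

variable {E F : Type*} [NormedAddCommGroup E] [NormedSpace ℝ E] [CompleteSpace E]
  [NormedAddCommGroup F] [NormedSpace ℝ F] {f : ℝ → E} {a b : ℝ}

-- `F` need not be complete, so its own Bochner integrals may be junk.
theorem norm_map_intervalIntegral (ι : E →L[ℝ] F) (hf : IntervalIntegrable f volume a b) :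
    ‖ι (∫ s in a..b, f s)‖ = ‖∫ s in a..b, (ι (f s) : UniformSpace.Completion F)‖ := by
  rw [← UniformSpace.Completion.norm_coe]
  exact congrArg norm
    (((UniformSpace.Completion.toComplL (𝕜 := ℝ)).comp ι).intervalIntegral_comp_comm hf).symm

theorem norm_map_intervalIntegral_le (ι : E →L[ℝ] F) (hf : IntervalIntegrable f volume a b)
    (hab : a ≤ b) {g : ℝ → ℝ} (hg : IntervalIntegrable g volume a b)
    (hfg : ∀ s ∈ Icc a b, ‖ι (f s)‖ ≤ g s) :
    ‖ι (∫ s in a..b, f s)‖ ≤ ∫ s in a..b, g s := by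
  rw [norm_map_intervalIntegral ι hf]
  refine intervalIntegral.norm_integral_le_of_norm_le hab (ae_of_all _ fun s hs => ?_) hg
  rw [UniformSpace.Completion.norm_coe]
  exact hfg s (Ioc_subset_Icc_self hs)

theorem norm_map_integral_smul_le_of_periodic (ι : E →L[ℝ] F) {b : ℝ → ℝ} {G : ℝ → E}
    {σ M K η T : ℝ} (hσ : 0 < σ) (hb : Function.Periodic b σ) (hM : ∀ t, |b t| ≤ M)
    (hbi : ∀ s t, IntervalIntegrable b volume s t) (hb0 : ∫ s in (0 : ℝ)..σ, b s = 0)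
    (hT : 0 ≤ T) (hG : ContinuousOn G (Icc 0 T)) (hK : ∀ t ∈ Icc 0 T, ‖ι (G t)‖ ≤ K)
    (hη : ∀ s ∈ Icc 0 T, ∀ t ∈ Icc 0 T, s ≤ t → t ≤ s + σ → ‖ι (G t) - ι (G s)‖ ≤ η) :
    ‖ι (∫ s in (0 : ℝ)..T, b s • G s)‖ ≤ M * (T * η + σ * K) := by
  rw [norm_map_intervalIntegral ι ((hbi 0 T).smul_continuousOn (uIcc_of_le hT ▸ hG))]
  simp only [map_smul, UniformSpace.Completion.coe_smul]
  refine norm_integral_smul_le_of_periodic hσ hb hM hbi hb0 hT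
    (((UniformSpace.Completion.toComplL (𝕜 := ℝ)).comp ι).continuous.comp_continuousOn hG)
    (fun t ht => ?_) fun s hs t ht hst hts => ?_
  · rw [UniformSpace.Completion.norm_coe]
    exact hK t ht
  · rw [← UniformSpace.Completion.coe_sub, UniformSpace.Completion.norm_coe]
    exact hη s hs t ht hst hts

end NormMapIntegral

namespace IsUnitaryGroupGeneratedBy

variable {H : Type*} [NormedAddCommGroup H] [InnerProductSpace ℂ H]
  {A : H →ₗ.[ℂ] H} {U : ℝ → H →L[ℂ] H}

theorem map_add_apply (hU : IsUnitaryGroupGeneratedBy A U) (s t : ℝ) (x : H) :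
    U (s + t) x = U s (U t x) := by
  rw [hU.map_add, ContinuousLinearMap.comp_apply]

theorem continuous_uncurry (hU : IsUnitaryGroupGeneratedBy A U) :
    Continuous fun p : ℝ × H => U p.1 p.2 := by
  refine continuous_iff_continuousAt.2 fun ⟨t, x⟩ => tendsto_iff_norm_sub_tendsto_zero.2 ?_
  have hcont : Continuous fun p : ℝ × H => ‖p.2 - x‖ + ‖U p.1 x - U t x‖ :=
    (continuous_snd.sub continuous_const).norm.add
      (((hU.strongly_continuous x).comp continuous_fst).sub continuous_const).norm
  refine squeeze_zero (fun _ => norm_nonneg _) (fun p => ?_)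
    (by simpa using hcont.tendsto (t, x))
  rw [← hU.norm_map p.1 (p.2 - x), map_sub]
  exact norm_sub_le_norm_sub_add_norm_sub _ _ _

theorem continuousOn_comp (hU : IsUnitaryGroupGeneratedBy A U) {a : ℝ → ℝ} {v : ℝ → H} {s : Set ℝ}
    (ha : ContinuousOn a s) (hv : ContinuousOn v s) : ContinuousOn (fun t => U (a t) (v t)) s :=
  hU.continuous_uncurry.comp_continuousOn (ha.prodMk hv)

theorem exists_norm_sub_le_of_isCompact (hU : IsUnitaryGroupGeneratedBy A U) {s : Set H}
    (hs : IsCompact s) {ε : ℝ} (hε : 0 < ε) :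
    ∃ δ > 0, ∀ x ∈ s, ∀ a b : ℝ, |a - b| ≤ δ → ‖U a x - U b x‖ ≤ ε := by
  have hcont : Continuous fun p : ℝ × H => ‖U p.1 p.2 - p.2‖ :=
    (hU.continuous_uncurry.sub continuous_snd).norm
  have hnear : ∀ᶠ r : ℝ in 𝓝 0, ∀ x ∈ s, ‖U r x - x‖ < ε := by
    refine hs.eventually_forall_of_forall_eventually fun x _ =>
      (hcont.tendsto (0, x)).eventually_lt_const ?_
    simpa [hU.map_zero] using hε
  obtain ⟨δ, hδ, hball⟩ := Metric.eventually_nhds_iff_ball.1 hnear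
  refine ⟨δ / 2, half_pos hδ, fun x hx a b hab => ?_⟩
  have hmem : a - b ∈ Metric.ball (0 : ℝ) δ := by
    rw [Metric.mem_ball, Real.dist_0_eq_abs]
    linarith
  have hsplit : U a x = U b (U (a - b) x) := by rw [← hU.map_add_apply, add_sub_cancel]
  rw [hsplit, ← map_sub, hU.norm_map]
  exact (hball _ hmem x hx).le

theorem map_mem_graph (hU : IsUnitaryGroupGeneratedBy A U) {x y : H} (h : (x, y) ∈ A.graph)
    (t : ℝ) : (U t x, U t y) ∈ A.graph := by
  have hderiv := ((U t).restrictScalars ℝ).hasFDerivAt.comp_hasDerivAt (0 : ℝ)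
    ((hU.generator x y).1 h)
  refine (hU.generator _ _).2 (HasDerivAt.congr_of_eventuallyEq (f := fun s => U t (U s x))
    (by simpa [Function.comp_def] using hderiv) (Eventually.of_forall fun s => ?_))
  simp only [← hU.map_add_apply, add_comm]

theorem hasDerivAt_apply (hU : IsUnitaryGroupGeneratedBy A U) {x y : H} (h : (x, y) ∈ A.graph)
    (t : ℝ) : HasDerivAt (fun t => U t x) (-(Complex.I • U t y)) t := by
  have hderiv := HasDerivAt.scomp_of_eq (h := fun s : ℝ => s - t) t
    ((hU.generator _ _).1 (hU.map_mem_graph h t)) ((hasDerivAt_id t).sub_const t)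
    (sub_self t).symm
  simpa [Function.comp_def, ← hU.map_add_apply] using hderiv

end IsUnitaryGroupGeneratedBy

section Embedding

variable {F H : Type*} [NormedAddCommGroup F] [InnerProductSpace ℂ F]
  [NormedAddCommGroup H] [InnerProductSpace ℂ H]
  {ι : H →L[ℂ] F} {A : H →ₗ.[ℂ] H} {D : H → F} {U : ℝ → H →L[ℂ] H}

/-- `D` extends the operator `A` to all of `H`, with values in the larger space `F`, and is
symmetric for the inner product that `F` induces on `H`. -/
structure IsSymmetricExtension (ι : H →L[ℂ] F) (A : H →ₗ.[ℂ] H) (D : H → F) : Prop where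
  symmetric : ∀ x y, inner ℂ (D x) (ι y) = inner ℂ (ι x) (D y)
  apply_eq : ∀ x y, (x, y) ∈ A.graph → D x = ι y

namespace IsSymmetricExtension

-- Hellinger–Toeplitz: symmetry turns the pointwise bound `‖D x‖` into a uniform one.
theorem exists_norm_map_le [CompleteSpace H] (hD : IsSymmetricExtension ι A D) :
    ∃ C, 0 ≤ C ∧ ∀ x y, (x, y) ∈ A.graph → ‖ι y‖ ≤ C * ‖x‖ := by
  let φ : H → H →L[ℂ] ℂ := fun z => ((‖ι z‖⁻¹ : ℝ) : ℂ) • (innerSL ℂ (D z)).comp ι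
  have hφ : ∀ z x, φ z x = (‖ι z‖⁻¹ : ℝ) * inner ℂ (ι z) (D x) := fun z x => by
    rw [← hD.symmetric]; rfl
  obtain ⟨C, hC⟩ := banach_steinhaus (g := φ) fun x => ⟨‖D x‖, fun z => by
    rw [hφ, norm_mul, Complex.norm_real, norm_inv, norm_norm]
    exact inv_mul_le_of_le_mul₀ (norm_nonneg _) (norm_nonneg _) (norm_inner_le_norm _ _)⟩
  refine ⟨C, (norm_nonneg _).trans (hC 0), fun x y h => ?_⟩
  have hxy := (φ y).le_of_opNorm_le (hC y) x
  rw [hφ, hD.apply_eq x y h, inner_self_eq_norm_sq_to_K, norm_mul, Complex.norm_real] at hxy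
  rcases eq_or_ne ‖ι y‖ 0 with h0 | h0
  · rw [h0]
    exact (by positivity : (0 : ℝ) ≤ _).trans hxy
  · simpa [h0, sq] using hxy

theorem norm_map_unitary_apply [CompleteSpace H] (hD : IsSymmetricExtension ι A D)
    (hdense : Dense (A.domain : Set H)) (hU : IsUnitaryGroupGeneratedBy A U) (t : ℝ) (x : H) :
    ‖ι (U t x)‖ = ‖ι x‖ := by
  refine hdense.induction (P := fun x => ‖ι (U t x)‖ = ‖ι x‖) (fun x hx => ?_)
    (isClosed_eq (by fun_prop) (by fun_prop)) x
  have hderiv : ∀ t, HasDerivAt (fun t => inner ℂ (ι (U t x)) (ι (U t x))) 0 t := fun t => by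
    have hG := A.mem_graph ⟨x, hx⟩
    have hιU := (ι.restrictScalars ℝ).hasFDerivAt.comp_hasDerivAt t (hU.hasDerivAt_apply hG t)
    refine (HasDerivAt.inner ℂ hιU hιU).congr_deriv ?_
    have hsymm := hD.symmetric (U t x) (U t x)
    rw [hD.apply_eq _ _ (hU.map_mem_graph hG t)] at hsymm
    simp only [ContinuousLinearMap.coe_restrictScalars', Function.comp_apply, map_neg, map_smul,
      inner_neg_right, inner_neg_left, inner_smul_right, inner_smul_left, Complex.conj_I, hsymm]
    ring
  have hconst := is_const_of_deriv_eq_zero (fun t => (hderiv t).differentiableAt)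
    (fun t => (hderiv t).deriv) t 0
  simp only [hU.map_zero, ContinuousLinearMap.id_apply, inner_self_eq_norm_sq_to_K] at hconst
  norm_cast at hconst
  exact (pow_left_inj₀ (norm_nonneg _) (norm_nonneg _) two_ne_zero).1 hconst

theorem exists_lipschitzWith_map_unitary [CompleteSpace H] (hD : IsSymmetricExtension ι A D)
    (hdense : Dense (A.domain : Set H)) (hU : IsUnitaryGroupGeneratedBy A U) :
    ∃ C : ℝ≥0, ∀ x, LipschitzWith (C * ‖x‖₊) fun t => ι (U t x) := by
  obtain ⟨C, hC0, hC⟩ := hD.exists_norm_map_le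
  lift C to ℝ≥0 using hC0
  refine ⟨C, fun x => LipschitzWith.of_dist_le_mul fun t s => ?_⟩
  refine hdense.induction
    (P := fun x => dist (ι (U t x)) (ι (U s x)) ≤ (C * ‖x‖₊ : ℝ≥0) * dist t s) (fun x hx => ?_)
    (isClosed_le (by fun_prop) (by fun_prop)) x
  have hG := A.mem_graph ⟨x, hx⟩
  have hderiv r := (ι.restrictScalars ℝ).hasFDerivAt.comp_hasDerivAt r (hU.hasDerivAt_apply hG r)
  refine (lipschitzWith_of_nnnorm_deriv_le (f := fun t => ι (U t x))
    (fun r => (hderiv r).differentiableAt) fun r => NNReal.coe_le_coe.1 ?_).dist_le_mul t s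
  refine (congrArg norm (hderiv r).deriv).trans_le ?_
  simpa [norm_smul, hU.norm_map] using hC _ _ (hU.map_mem_graph hG r)

end IsSymmetricExtension

end Embedding

section Duhamel

variable {H : Type*} [NormedAddCommGroup H] [InnerProductSpace ℂ H]
  {A : H →ₗ.[ℂ] H} {U : ℝ → H →L[ℂ] H} {α β : ℝ → ℝ} {u₀ : H} {T : ℝ} {g h : ℝ → H}

/-- The solution of `u' + i (α A u + β g) = 0`, `u(0) = u₀`, in the interaction picture:
transported back to time zero by the propagator `U (∫₀ᵗ α)` of the linear part. -/
def interactionPicture (U : ℝ → H →L[ℂ] H) (α β : ℝ → ℝ) (u₀ : H) (g : ℝ → H) (t : ℝ) : H :=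
  u₀ - Complex.I • ∫ s in (0 : ℝ)..t, β s • U (-∫ r in (0 : ℝ)..s, α r) (g s)

/-- The mild solution of `u' + i (α A u + β g) = 0`, `u(0) = u₀`, for a given forcing `g`. The
propagator `U (∫ₛᵗ α)` of Duhamel's formula is factored as `U (∫₀ᵗ α) U (-∫₀ˢ α)`. -/
def duhamelMap (U : ℝ → H →L[ℂ] H) (α β : ℝ → ℝ) (u₀ : H) (g : ℝ → H) (t : ℝ) : H :=
  U (∫ r in (0 : ℝ)..t, α r) (interactionPicture U α β u₀ g t)

theorem continuousOn_unitary_apply (hU : IsUnitaryGroupGeneratedBy A U)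
    (hα : ∀ s t, IntervalIntegrable α volume s t) (hg : ContinuousOn g (Icc 0 T)) :
    ContinuousOn (fun s => U (-∫ r in (0 : ℝ)..s, α r) (g s)) (Icc 0 T) :=
  hU.continuousOn_comp (intervalIntegral.continuous_primitive hα 0).neg.continuousOn hg

theorem intervalIntegrable_smul_unitary (hU : IsUnitaryGroupGeneratedBy A U)
    (hα : ∀ s t, IntervalIntegrable α volume s t) (hβ : ∀ s t, IntervalIntegrable β volume s t)
    (hg : ContinuousOn g (Icc 0 T)) {s t : ℝ} (hs : s ∈ Icc 0 T) (ht : t ∈ Icc 0 T) :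
    IntervalIntegrable (fun s => β s • U (-∫ r in (0 : ℝ)..s, α r) (g s)) volume s t :=
  (hβ s t).smul_continuousOn
    ((continuousOn_unitary_apply hU hα hg).mono (uIcc_subset_Icc hs ht))

theorem continuousOn_interactionPicture (hU : IsUnitaryGroupGeneratedBy A U)
    (hα : ∀ s t, IntervalIntegrable α volume s t) (hβ : ∀ s t, IntervalIntegrable β volume s t)
    (hT : 0 ≤ T) (hg : ContinuousOn g (Icc 0 T)) :
    ContinuousOn (interactionPicture U α β u₀ g) (Icc 0 T) := by
  have hprim := intervalIntegral.continuousOn_primitive_interval'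
    (intervalIntegrable_smul_unitary hU hα hβ hg (left_mem_Icc.2 hT) (right_mem_Icc.2 hT))
    left_mem_uIcc
  exact continuousOn_const.sub ((uIcc_of_le hT ▸ hprim).const_smul _)

theorem continuousOn_duhamelMap (hU : IsUnitaryGroupGeneratedBy A U)
    (hα : ∀ s t, IntervalIntegrable α volume s t) (hβ : ∀ s t, IntervalIntegrable β volume s t)
    (hT : 0 ≤ T) (hg : ContinuousOn g (Icc 0 T)) :
    ContinuousOn (duhamelMap U α β u₀ g) (Icc 0 T) :=
  hU.continuousOn_comp (intervalIntegral.continuous_primitive hα 0).continuousOn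
    (continuousOn_interactionPicture hU hα hβ hT hg)

theorem duhamelMap_apply [CompleteSpace H] (hU : IsUnitaryGroupGeneratedBy A U)
    (hα : ∀ s t, IntervalIntegrable α volume s t) (hβ : ∀ s t, IntervalIntegrable β volume s t)
    (hg : ContinuousOn g (Icc 0 T)) {t : ℝ} (ht : t ∈ Icc 0 T) :
    duhamelMap U α β u₀ g t = U (∫ r in (0 : ℝ)..t, α r) u₀ -
      Complex.I • ∫ s in (0 : ℝ)..t, β s • U (∫ r in s..t, α r) (g s) := by
  have hint := intervalIntegrable_smul_unitary hU hα hβ hg (left_mem_Icc.2 (ht.1.trans ht.2)) ht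
  have hfactor (s : ℝ) : U (∫ r in (0 : ℝ)..t, α r) (β s • U (-∫ r in (0 : ℝ)..s, α r) (g s)) =
      β s • U (∫ r in s..t, α r) (g s) := by
    rw [ContinuousLinearMap.map_smul_of_tower, ← hU.map_add_apply, ← sub_eq_add_neg,
      intervalIntegral.integral_interval_sub_left (hα 0 t) (hα 0 s)]
  simp only [duhamelMap, interactionPicture, map_sub, map_smul,
    ← ContinuousLinearMap.intervalIntegral_comp_comm _ hint, hfactor]

theorem isMildSolutionOn_iff [CompleteSpace H] {B : H → H} {u : ℝ → H}
    (hU : IsUnitaryGroupGeneratedBy A (unitaryGroup A))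
    (hα : ∀ s t, IntervalIntegrable α volume s t) (hβ : ∀ s t, IntervalIntegrable β volume s t)
    (hB : Continuous B) :
    IsMildSolutionOn A B α β u₀ T u ↔ ContinuousOn u (Icc 0 T) ∧
      EqOn u (duhamelMap (unitaryGroup A) α β u₀ (B ∘ u)) (Icc 0 T) := by
  have happly (hu : ContinuousOn u (Icc 0 T)) {t : ℝ} (ht : t ∈ Icc 0 T) :=
    duhamelMap_apply (u₀ := u₀) hU hα hβ (hB.comp_continuousOn hu) ht
  exact ⟨fun h => ⟨h.continuousOn, fun t ht =>
      (h.duhamel t ht).trans (happly h.continuousOn ht).symm⟩,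
    fun h => ⟨h.1, fun t ht => (h.2 ht).trans (happly h.1 ht)⟩⟩

theorem norm_map_duhamelMap_sub_le [CompleteSpace H] {F : Type*} [NormedAddCommGroup F]
    [NormedSpace ℂ F] (ι : H →L[ℂ] F) (hU : IsUnitaryGroupGeneratedBy A U)
    (hιU : ∀ t x, ‖ι (U t x)‖ = ‖ι x‖)
    (hα : ∀ s t, IntervalIntegrable α volume s t) (hβ : ∀ s t, IntervalIntegrable β volume s t)
    {M : ℝ} (hM : ∀ t, |β t| ≤ M) (hg : ContinuousOn g (Icc 0 T)) (hh : ContinuousOn h (Icc 0 T))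
    {f : ℝ → ℝ} (hf : ContinuousOn f (Icc 0 T)) (hle : ∀ s ∈ Icc 0 T, ‖ι (g s) - ι (h s)‖ ≤ f s)
    {t : ℝ} (ht : t ∈ Icc 0 T) :
    ‖ι (duhamelMap U α β u₀ g t) - ι (duhamelMap U α β u₀ h t)‖ ≤
      M * ∫ s in (0 : ℝ)..t, f s := by
  have h0 : (0 : ℝ) ∈ Icc 0 T := left_mem_Icc.2 (ht.1.trans ht.2)
  have hgi := intervalIntegrable_smul_unitary hU hα hβ hg h0 ht
  have hhi := intervalIntegrable_smul_unitary hU hα hβ hh h0 ht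
  have hfi : IntervalIntegrable f volume 0 t := (hf.mono (uIcc_subset_Icc h0 ht)).intervalIntegrable
  rw [duhamelMap, duhamelMap, ← map_sub, ← map_sub, hιU, interactionPicture, interactionPicture,
    sub_sub_sub_cancel_left, ← smul_sub, map_smul, norm_smul, Complex.norm_I, one_mul,
    ← intervalIntegral.integral_sub hhi hgi, ← intervalIntegral.integral_const_mul]
  refine norm_map_intervalIntegral_le (ι.restrictScalars ℝ) (hhi.sub hgi) ht.1 (hfi.const_mul M)
    fun s hs => ?_
  rw [← smul_sub, ← map_sub, map_smul, norm_smul, ContinuousLinearMap.coe_restrictScalars', hιU,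
    map_sub, norm_sub_rev]
  exact mul_le_mul (hM s) (hle s ⟨hs.1, hs.2.trans ht.2⟩) (norm_nonneg _)
    ((abs_nonneg _).trans (hM s))

theorem isVolterraOn_duhamelMap [CompleteSpace H] {B : H → H}
    (hU : IsUnitaryGroupGeneratedBy A U)
    (hα : ∀ s t, IntervalIntegrable α volume s t) (hβ : ∀ s t, IntervalIntegrable β volume s t)
    {M L : ℝ} (hM : ∀ t, |β t| ≤ M) (hT : 0 ≤ T) (hB : Continuous B) {s : Set (ℝ → H)}
    (hs : ∀ v ∈ s, ContinuousOn v (Icc 0 T))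
    (hL : ∀ v ∈ s, ∀ w ∈ s, ∀ t ∈ Icc 0 T, ‖B (v t) - B (w t)‖ ≤ L * ‖v t - w t‖) :
    IsVolterraOn (fun v => duhamelMap U α β u₀ (B ∘ v)) T (M * L) s where
  continuousOn v hv := continuousOn_duhamelMap hU hα hβ hT (hB.comp_continuousOn (hs v hv))
  norm_sub_le v hv w hw t ht := by
    rw [mul_assoc, ← intervalIntegral.integral_const_mul]
    exact norm_map_duhamelMap_sub_le (.id ℂ H) hU hU.norm_map hα hβ hM
      (hB.comp_continuousOn (hs v hv)) (hB.comp_continuousOn (hs w hw))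
      (continuousOn_const.mul ((hs v hv).sub (hs w hw)).norm) (hL v hv w hw) ht

end Duhamel

namespace IsMildSolutionOn

variable {H : Type*} [NormedAddCommGroup H] [InnerProductSpace ℂ H]
  {A : H →ₗ.[ℂ] H} {B : H → H} {α β : ℝ → ℝ} {u₀ : H} {T : ℝ} {u v : ℝ → H}

theorem mono (hu : IsMildSolutionOn A B α β u₀ T u) {t : ℝ} (ht : t ≤ T) :
    IsMildSolutionOn A B α β u₀ t u :=
  ⟨hu.continuousOn.mono (Icc_subset_Icc_right ht), fun s hs =>
    hu.duhamel s (Icc_subset_Icc_right ht hs)⟩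

theorem eqOn [CompleteSpace H] (hu : IsMildSolutionOn A B α β u₀ T u)
    (hv : IsMildSolutionOn A B α β u₀ T v)
    (hU : IsUnitaryGroupGeneratedBy A (unitaryGroup A))
    (hα : ∀ s t, IntervalIntegrable α volume s t) (hβ : ∀ s t, IntervalIntegrable β volume s t)
    {M : ℝ} (hM : ∀ t, |β t| ≤ M) (hB : LocallyLipschitz B) : EqOn u v (Icc 0 T) := by
  intro t ht
  obtain ⟨L, hL⟩ := hB.locallyLipschitzOn.exists_lipschitzOnWith_of_compact
    ((isCompact_Icc.image_of_continuousOn hu.continuousOn).union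
      (isCompact_Icc.image_of_continuousOn hv.continuousOn))
  have hmem : ∀ w ∈ ({u, v} : Set (ℝ → H)), ∀ t ∈ Icc 0 T, w t ∈ u '' Icc 0 T ∪ v '' Icc 0 T := by
    rintro w (rfl | rfl) t ht
    exacts [.inl (mem_image_of_mem _ ht), .inr (mem_image_of_mem _ ht)]
  have hP := isVolterraOn_duhamelMap (u₀ := u₀) (s := {u, v}) hU hα hβ hM (ht.1.trans ht.2)
    hB.continuous (by rintro w (rfl | rfl); exacts [hu.continuousOn, hv.continuousOn])
    fun w hw w' hw' t ht => hL.norm_sub_le (hmem w hw t ht) (hmem w' hw' t ht)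
  exact hP.eqOn_of_eqOn (mul_nonneg ((abs_nonneg _).trans (hM 0)) L.coe_nonneg)
    (.inl rfl) (.inr rfl)
    ((isMildSolutionOn_iff hU hα hβ hB.continuous).1 hu).2
    ((isMildSolutionOn_iff hU hα hβ hB.continuous).1 hv).2 ht

theorem flow_eq [CompleteSpace H] (hu : IsMildSolutionOn A B α β u₀ T u)
    (hU : IsUnitaryGroupGeneratedBy A (unitaryGroup A))
    (hα : ∀ s t, IntervalIntegrable α volume s t) (hβ : ∀ s t, IntervalIntegrable β volume s t)
    {M : ℝ} (hM : ∀ t, |β t| ≤ M) (hB : LocallyLipschitz B) {t : ℝ} (ht : t ∈ Icc 0 T) :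
    flow A B α β t u₀ = u t := by
  have hex : ∃ u, IsMildSolutionOn A B α β u₀ t u := ⟨u, hu.mono ht.2⟩
  rw [flow, dif_pos hex]
  exact hex.choose_spec.eqOn (hu.mono ht.2) hU hα hβ hM hB (right_mem_Icc.2 ht.1)

theorem le_existenceTime {T : ℝ≥0} (hu : IsMildSolutionOn A B α β u₀ T u) :
    (T : ℝ≥0∞) ≤ existenceTime A B α β u₀ :=
  le_iSup₂_of_le T ⟨u, hu⟩ le_rfl

end IsMildSolutionOn

/-! ### Consistency of the splitting -/

namespace IsSplittingProfile

variable {τ M T : ℝ} {p : ℝ → ℝ} {n : ℕ}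

theorem intervalIntegrable_comp_mul (hp : IsSplittingProfile τ p) (hn : 0 < n) (s t : ℝ) :
    IntervalIntegrable (fun s => p (n * s)) volume s t := by
  have hp' : IntervalIntegrable p volume (n * s) (n * t) :=
    (hp.locallyIntegrable.integrableOn_isCompact isCompact_uIcc).intervalIntegrable
  have hn' : (n : ℝ) ≠ 0 := by positivity
  simpa [mul_div_cancel_left₀ _ hn'] using hp'.comp_mul_left (c := (n : ℝ))

theorem integral_comp_mul_sub_one (hp : IsSplittingProfile τ p) (hτ : τ ≠ 0) (hn : 0 < n) :
    ∫ s in (0 : ℝ)..(τ / n), (p (n * s) - 1) = 0 := by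
  have hn' : (n : ℝ) ≠ 0 := by positivity
  have hmean : ∫ t in (0 : ℝ)..τ, p t = τ := by
    simpa using (inv_mul_eq_iff_eq_mul₀ hτ).1 hp.mean_one
  rw [intervalIntegral.integral_sub (hp.intervalIntegrable_comp_mul hn _ _)
    intervalIntegrable_const, intervalIntegral.integral_comp_mul_left _ hn', mul_zero,
    mul_div_cancel₀ _ hn', hmean, integral_one, smul_eq_mul]
  ring

theorem norm_map_integral_sub_one_smul_le {E F : Type*} [NormedAddCommGroup E] [NormedSpace ℝ E]
    [CompleteSpace E] [NormedAddCommGroup F] [NormedSpace ℝ F] (ι : E →L[ℝ] F)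
    (hp : IsSplittingProfile τ p) (hτ : 0 < τ) (hM : ∀ t, |p t| ≤ M) (hn : 0 < n)
    {G : ℝ → E} {K η : ℝ} (hT : 0 ≤ T) (hG : ContinuousOn G (Icc 0 T))
    (hK : ∀ t ∈ Icc 0 T, ‖ι (G t)‖ ≤ K)
    (hη : ∀ s ∈ Icc 0 T, ∀ t ∈ Icc 0 T, s ≤ t → t ≤ s + τ / n → ‖ι (G t) - ι (G s)‖ ≤ η) :
    ‖ι (∫ s in (0 : ℝ)..T, (p (n * s) - 1) • G s)‖ ≤ (M + 1) * (T * η + τ / n * K) := by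
  have hn' : (0 : ℝ) < n := by positivity
  refine norm_map_integral_smul_le_of_periodic ι (div_pos hτ hn') (fun s => ?_) (fun s => ?_)
    (fun s t => (hp.intervalIntegrable_comp_mul hn s t).sub intervalIntegrable_const)
    (hp.integral_comp_mul_sub_one hτ.ne' hn) hT hG hK hη
  · rw [mul_add, mul_div_cancel₀ _ hn'.ne', hp.periodic]
  · exact (abs_sub _ _).trans (by simpa using hM (n * s))

theorem abs_integral_comp_mul_sub_le (hp : IsSplittingProfile τ p) (hτ : 0 < τ)
    (hM : ∀ t, |p t| ≤ M) (hn : 0 < n) (hT : 0 ≤ T) :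
    |(∫ s in (0 : ℝ)..T, p (n * s)) - T| ≤ (M + 1) * τ / n := by
  have hle := hp.norm_map_integral_sub_one_smul_le (.id ℝ ℝ) hτ hM hn (G := fun _ => 1) (K := 1)
    (η := 0) hT continuousOn_const (by simp) (by simp)
  simp only [smul_eq_mul, mul_one, mul_zero, zero_add, ContinuousLinearMap.id_apply] at hle
  rw [intervalIntegral.integral_sub (hp.intervalIntegrable_comp_mul hn _ _)
      intervalIntegrable_const, integral_one, sub_zero, Real.norm_eq_abs] at hle
  rwa [mul_div_assoc]

end IsSplittingProfile

section Consistency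

variable {H F : Type*} [NormedAddCommGroup H] [InnerProductSpace ℂ H]
  [NormedAddCommGroup F] [NormedSpace ℂ F] {A : H →ₗ.[ℂ] H} {U : ℝ → H →L[ℂ] H}
  {α β : ℝ → ℝ} {u₀ : H} {T t : ℝ} {g : ℝ → H}

theorem interactionPicture_sub_interactionPicture_one (hU : IsUnitaryGroupGeneratedBy A U)
    (hα : ∀ s t, IntervalIntegrable α volume s t) (hβ : ∀ s t, IntervalIntegrable β volume s t)
    (hg : ContinuousOn g (Icc 0 t)) (ht : 0 ≤ t) :
    interactionPicture U α β u₀ g t - interactionPicture U (fun _ => 1) (fun _ => 1) u₀ g t =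
      -(Complex.I • ((∫ s in (0 : ℝ)..t,
        β s • (U (-∫ r in (0 : ℝ)..s, α r) (g s) - U (-s) (g s))) +
        ∫ s in (0 : ℝ)..t, (β s - 1) • U (-s) (g s))) := by
  have h0 := left_mem_Icc.2 ht
  have ht' := right_mem_Icc.2 ht
  have hone (s t : ℝ) : IntervalIntegrable (fun _ : ℝ => (1 : ℝ)) volume s t :=
    intervalIntegrable_const
  have hαβ := intervalIntegrable_smul_unitary hU hα hβ hg h0 ht'
  have hβ1 := intervalIntegrable_smul_unitary hU hone hβ hg h0 ht'
  have h11 := intervalIntegrable_smul_unitary hU hone hone hg h0 ht'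
  simp only [integral_one, sub_zero] at hβ1 h11
  simp only [interactionPicture, smul_sub, sub_smul, integral_one, sub_zero]
  rw [intervalIntegral.integral_sub hαβ hβ1, intervalIntegral.integral_sub hβ1 h11,
    sub_add_sub_cancel, smul_sub, neg_sub, sub_sub_sub_cancel_left]

-- The three errors come from the outer propagator, the inner propagator and the averaging of `β`.
theorem norm_map_duhamelMap_sub_duhamelMap_one_le [CompleteSpace H] (ι : H →L[ℂ] F)
    (hU : IsUnitaryGroupGeneratedBy A U) (hιU : ∀ t x, ‖ι (U t x)‖ = ‖ι x‖)
    (hα : ∀ s t, IntervalIntegrable α volume s t) (hβ : ∀ s t, IntervalIntegrable β volume s t)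
    {M ω₀ ω₁ ω₂ : ℝ} (hM : ∀ t, |β t| ≤ M) (hg : ContinuousOn g (Icc 0 t)) (ht : 0 ≤ t)
    (h₀ : ‖ι (U (∫ r in (0 : ℝ)..t, α r) (interactionPicture U (fun _ => 1) (fun _ => 1) u₀ g t)) -
      ι (U t (interactionPicture U (fun _ => 1) (fun _ => 1) u₀ g t))‖ ≤ ω₀)
    (h₁ : ∀ s ∈ Icc 0 t, ‖ι (U (-∫ r in (0 : ℝ)..s, α r) (g s)) - ι (U (-s) (g s))‖ ≤ ω₁)
    (h₂ : ‖ι (∫ s in (0 : ℝ)..t, (β s - 1) • U (-s) (g s))‖ ≤ ω₂) :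
    ‖ι (duhamelMap U α β u₀ g t) - ι (duhamelMap U (fun _ => 1) (fun _ => 1) u₀ g t)‖ ≤
      ω₀ + (M * ω₁ * t + ω₂) := by
  set z := interactionPicture U α β u₀ g t
  set z₁ := interactionPicture U (fun _ => 1) (fun _ => 1) u₀ g t with hz₁
  have hcont : ContinuousOn (fun s => U (-∫ r in (0 : ℝ)..s, α r) (g s) - U (-s) (g s))
      (uIcc 0 t) := uIcc_of_le ht ▸ (continuousOn_unitary_apply hU hα hg).sub
    (hU.continuousOn_comp continuousOn_neg hg)
  have hinner : ‖ι (∫ s in (0 : ℝ)..t,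
      β s • (U (-∫ r in (0 : ℝ)..s, α r) (g s) - U (-s) (g s)))‖ ≤ M * ω₁ * t := by
    refine (norm_map_intervalIntegral_le (ι.restrictScalars ℝ) ((hβ 0 t).smul_continuousOn hcont)
      ht (intervalIntegrable_const (c := M * ω₁)) fun s hs => ?_).trans_eq (by simp; ring)
    rw [map_smul, norm_smul, map_sub]
    exact mul_le_mul (hM s) (h₁ s hs) (norm_nonneg _) ((abs_nonneg _).trans (hM s))
  have hprofile : ‖ι (z - z₁)‖ ≤ M * ω₁ * t + ω₂ := by
    rw [interactionPicture_sub_interactionPicture_one hU hα hβ hg ht, map_neg, norm_neg, map_smul,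
      norm_smul, Complex.norm_I, one_mul, map_add]
    exact norm_add_le_of_le hinner h₂
  rw [duhamelMap, duhamelMap, integral_one, sub_zero, ← hz₁]
  refine (norm_sub_le_norm_sub_add_norm_sub _ (ι (U (∫ r in (0 : ℝ)..t, α r) z₁)) _).trans ?_
  rw [← map_sub, ← map_sub, hιU, add_comm]
  exact add_le_add h₀ hprofile

theorem norm_map_duhamelMap_splitting_sub_le [CompleteSpace H] (ι : H →L[ℂ] F)
    (hU : IsUnitaryGroupGeneratedBy A U) (hιU : ∀ t x, ‖ι (U t x)‖ = ‖ι x‖) {τ Mα Mβ K ω : ℝ}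
    (hτ : 0 < τ) (hα : IsSplittingProfile τ α) (hβ : IsSplittingProfile τ β)
    (hMα : ∀ t, |α t| ≤ Mα) (hMβ : ∀ t, |β t| ≤ Mβ) {n : ℕ} (hn : 0 < n)
    (hg : ContinuousOn g (Icc 0 T)) (hK : ∀ s ∈ Icc 0 T, ‖ι (g s)‖ ≤ K) (hKω : τ / n * K ≤ ω)
    (h₀ : ∀ t ∈ Icc 0 T, ∀ r, |r - t| ≤ (Mα + 1) * τ / n →
      ‖ι (U r (interactionPicture U (fun _ => 1) (fun _ => 1) u₀ g t)) -
        ι (U t (interactionPicture U (fun _ => 1) (fun _ => 1) u₀ g t))‖ ≤ ω)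
    (h₁ : ∀ s ∈ Icc 0 T, ∀ r, |r - s| ≤ (Mα + 1) * τ / n →
      ‖ι (U (-r) (g s)) - ι (U (-s) (g s))‖ ≤ ω)
    (h₂ : ∀ r ∈ Icc 0 T, ∀ s ∈ Icc 0 T, r ≤ s → s ≤ r + τ / n →
      ‖ι (U (-s) (g s)) - ι (U (-r) (g r))‖ ≤ ω) (ht : t ∈ Icc 0 T) :
    ‖ι (duhamelMap U (fun s => α (n * s)) (fun s => β (n * s)) u₀ g t) -
      ι (duhamelMap U (fun _ => 1) (fun _ => 1) u₀ g t)‖ ≤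
      (1 + Mβ * T + (Mβ + 1) * (T + 1)) * ω := by
  have hMβ0 : 0 ≤ Mβ := (abs_nonneg _).trans (hMβ 0)
  have htime (s : ℝ) (hs : 0 ≤ s) := hα.abs_integral_comp_mul_sub_le hτ hMα hn hs
  have hsub : Icc 0 t ⊆ Icc 0 T := Icc_subset_Icc_right ht.2
  have hω : 0 ≤ ω := (norm_nonneg _).trans (h₀ t ht _ (htime t ht.1))
  have haverage := hβ.norm_map_integral_sub_one_smul_le (ι.restrictScalars ℝ) hτ hMβ hn ht.1
    (hU.continuousOn_comp continuousOn_neg (hg.mono hsub))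
    (fun s hs => (hιU _ _).trans_le (hK s (hsub hs)))
    (fun r hr s hs => h₂ r (hsub hr) s (hsub hs))
  calc _ ≤ ω + (Mβ * ω * t + (Mβ + 1) * (t * ω + τ / n * K)) :=
        norm_map_duhamelMap_sub_duhamelMap_one_le ι hU hιU (hα.intervalIntegrable_comp_mul hn)
          (hβ.intervalIntegrable_comp_mul hn) (fun s => hMβ _) (hg.mono hsub) ht.1
          (h₀ t ht _ (htime t ht.1)) (fun s hs => h₁ s (hsub hs) _ (htime s hs.1)) haverage
    _ ≤ ω + (Mβ * ω * T + (Mβ + 1) * (T * ω + ω)) := by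
        gcongr
        exacts [ht.2, ht.2]
    _ = _ := by ring

theorem tendstoUniformlyOn_duhamelMap_splitting [CompleteSpace H]
    (hU : IsUnitaryGroupGeneratedBy A U) {τ : ℝ} (hτ : 0 < τ) (hα : IsSplittingProfile τ α)
    (hβ : IsSplittingProfile τ β) (hT : 0 ≤ T) (hg : ContinuousOn g (Icc 0 T)) :
    TendstoUniformlyOn
      (fun n : ℕ => duhamelMap U (fun s => α (n * s)) (fun s => β (n * s)) u₀ g)
      (duhamelMap U (fun _ => 1) (fun _ => 1) u₀ g) atTop (Icc 0 T) := by
  obtain ⟨Mα, hMα⟩ := hα.bounded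
  obtain ⟨Mβ, hMβ⟩ := hβ.bounded
  refine Metric.tendstoUniformlyOn_iff.2 fun ε hε => ?_
  set c := 1 + Mβ * T + (Mβ + 1) * (T + 1)
  obtain ⟨ω, hω, hωε⟩ : ∃ ω > 0, c * ω < ε := exists_pos_mul_lt hε c
  have hone (s t : ℝ) : IntervalIntegrable (fun _ : ℝ => (1 : ℝ)) volume s t :=
    intervalIntegrable_const
  obtain ⟨K, hK⟩ := isCompact_Icc.exists_bound_of_continuousOn hg
  obtain ⟨δ₀, hδ₀, h₀⟩ := hU.exists_norm_sub_le_of_isCompact (isCompact_Icc.image_of_continuousOn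
    (continuousOn_interactionPicture (u₀ := u₀) hU hone hone hT hg)) hω
  obtain ⟨δ₁, hδ₁, h₁⟩ :=
    hU.exists_norm_sub_le_of_isCompact (isCompact_Icc.image_of_continuousOn hg) hω
  obtain ⟨δ₂, hδ₂, h₂⟩ := Metric.uniformContinuousOn_iff_le.1
    (isCompact_Icc.uniformContinuousOn_of_continuous
      (hU.continuousOn_comp continuousOn_neg hg)) ω hω
  have hsmall {C δ : ℝ} (hδ : 0 < δ) : ∀ᶠ n : ℕ in atTop, C / n ≤ δ :=
    (tendsto_const_div_atTop_nhds_zero_nat C).eventually (ge_mem_nhds hδ)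
  filter_upwards [eventually_gt_atTop 0, hsmall hδ₀, hsmall hδ₁,
    hsmall (C := τ) hδ₂, hsmall hω]
    with n hn hn₀ hn₁ hn₂ hnK t ht
  rw [dist_comm, dist_eq_norm]
  refine (norm_map_duhamelMap_splitting_sub_le (.id ℂ H) hU hU.norm_map hτ hα hβ hMα hMβ hn hg hK
    ((div_mul_eq_mul_div _ _ _).trans_le hnK)
    (fun t ht r hr => h₀ _ (mem_image_of_mem _ ht) _ _ (hr.trans hn₀))
    (fun s hs r hr => h₁ _ (mem_image_of_mem _ hs) _ _ ?_)
    (fun r hr s hs hrs hsr => ?_) ht).trans_lt hωε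
  · rw [neg_sub_neg, abs_sub_comm]
    exact hr.trans hn₁
  · refine (dist_eq_norm _ _).symm.trans_le (h₂ s hs r hr ?_)
    rw [Real.dist_eq, abs_of_nonneg (sub_nonneg.2 hrs)]
    linarith

theorem lipschitzOnWith_interactionPicture (hU : IsUnitaryGroupGeneratedBy A U)
    (hα : ∀ s t, IntervalIntegrable α volume s t) (hβ : ∀ s t, IntervalIntegrable β volume s t)
    {M K : ℝ≥0} (hM : ∀ t, |β t| ≤ M) (hg : ContinuousOn g (Icc 0 T))
    (hK : ∀ s ∈ Icc 0 T, ‖g s‖ ≤ K) :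
    LipschitzOnWith (M * K) (interactionPicture U α β u₀ g) (Icc 0 T) := by
  refine .of_dist_le_mul fun t ht s hs => ?_
  have h0 : (0 : ℝ) ∈ Icc 0 T := left_mem_Icc.2 (ht.1.trans ht.2)
  rw [dist_comm, dist_eq_norm, interactionPicture, interactionPicture, sub_sub_sub_cancel_left,
    ← smul_sub, norm_smul, Complex.norm_I, one_mul, intervalIntegral.integral_interval_sub_left
      (intervalIntegrable_smul_unitary hU hα hβ hg h0 ht)
      (intervalIntegrable_smul_unitary hU hα hβ hg h0 hs)]
  refine intervalIntegral.norm_integral_le_of_norm_le_const fun r hr => ?_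
  rw [norm_smul, hU.norm_map, NNReal.coe_mul]
  exact mul_le_mul (hM r) (hK r (uIcc_subset_Icc hs ht (uIoc_subset_uIcc hr))) (norm_nonneg _)
    M.coe_nonneg

theorem lipschitzOnWith_map_unitary_apply (ι : H →L[ℂ] F) (hιU : ∀ t x, ‖ι (U t x)‖ = ‖ι x‖)
    {C k K Λ : ℝ≥0} (hC : ∀ x, LipschitzWith (C * ‖x‖₊) fun t => ι (U t x)) {σ : ℝ → ℝ}
    (hσ : LipschitzWith k σ) {s : Set ℝ} (hg : LipschitzOnWith Λ (ι ∘ g) s)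
    (hK : ∀ t ∈ s, ‖g t‖ ≤ K) :
    LipschitzOnWith (C * K * k + Λ) (fun t => ι (U (σ t) (g t))) s := by
  refine .of_dist_le_mul fun t ht r hr => ?_
  have hpropagator : dist (ι (U (σ t) (g t))) (ι (U (σ r) (g t))) ≤ C * K * (k * dist t r) := by
    refine ((hC (g t)).dist_le_mul _ _).trans ?_
    push_cast
    gcongr
    exacts [hK t ht, hσ.dist_le_mul t r]
  have hpoint : dist (ι (U (σ r) (g t))) (ι (U (σ r) (g r))) ≤ Λ * dist t r := by
    rw [dist_eq_norm, ← map_sub, ← map_sub, hιU, map_sub, ← dist_eq_norm]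
    exact hg.dist_le_mul t ht r hr
  refine (dist_triangle _ (ι (U (σ r) (g t))) _).trans
    ((add_le_add hpropagator hpoint).trans_eq ?_)
  push_cast
  ring

theorem exists_lipschitzOnWith_map_duhamelMap_one (ι : H →L[ℂ] F)
    (hU : IsUnitaryGroupGeneratedBy A U) (hιU : ∀ t x, ‖ι (U t x)‖ = ‖ι x‖) {C : ℝ≥0}
    (hC : ∀ x, LipschitzWith (C * ‖x‖₊) fun t => ι (U t x)) (hT : 0 ≤ T)
    (hg : ContinuousOn g (Icc 0 T)) :
    ∃ Λ, LipschitzOnWith Λ (ι ∘ duhamelMap U (fun _ => 1) (fun _ => 1) u₀ g) (Icc 0 T) := by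
  have hone (s t : ℝ) : IntervalIntegrable (fun _ : ℝ => (1 : ℝ)) volume s t :=
    intervalIntegrable_const
  have h0 : (0 : ℝ) ∈ Icc 0 T := left_mem_Icc.2 hT
  obtain ⟨K, hK⟩ := isCompact_Icc.exists_bound_of_continuousOn hg
  lift K to ℝ≥0 using (norm_nonneg _).trans (hK 0 h0)
  obtain ⟨R, hR⟩ := isCompact_Icc.exists_bound_of_continuousOn
    (continuousOn_interactionPicture (u₀ := u₀) hU hone hone hT hg)
  lift R to ℝ≥0 using (norm_nonneg _).trans (hR 0 h0)
  have hz := ι.lipschitz.comp_lipschitzOnWith (lipschitzOnWith_interactionPicture (u₀ := u₀) hU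
    hone hone (M := 1) (by simp) hg hK)
  have hσ : LipschitzWith 1 fun t : ℝ => ∫ _ in (0 : ℝ)..t, (1 : ℝ) := by
    simp only [integral_one, sub_zero]
    exact .id
  exact ⟨_, lipschitzOnWith_map_unitary_apply ι hιU hC hσ hz hR⟩

theorem LocallyLipschitzAlong.exists_lipschitzOnWith_map_comp {ι : H →L[ℂ] F} {B : H → H}
    {u : ℝ → H} {Λ : ℝ≥0} {s : Set ℝ} (hB : LocallyLipschitzAlong ι B) (hs : IsCompact s)
    (hu : ContinuousOn u s) (hιu : LipschitzOnWith Λ (ι ∘ u) s) :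
    ∃ Λ', LipschitzOnWith Λ' (ι ∘ B ∘ u) s := by
  refine LocallyLipschitzOn.exists_lipschitzOnWith_of_compact hs fun t ht => ?_
  obtain ⟨L, v, hv, hL⟩ := hB (u t)
  refine ⟨L.toNNReal * Λ, u ⁻¹' v ∩ s, inter_mem (hu t ht hv) self_mem_nhdsWithin,
    .of_dist_le_mul fun r hr q hq => ?_⟩
  calc dist (ι (B (u r))) (ι (B (u q))) ≤ L.toNNReal * dist (ι (u r)) (ι (u q)) := by
        rw [dist_eq_norm, dist_eq_norm]
        exact (hL _ hr.1 _ hq.1).trans (by gcongr; exact L.le_coe_toNNReal)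
    _ ≤ L.toNNReal * (Λ * dist r q) := by gcongr; exact hιu.dist_le_mul r hr.2 q hq.2
    _ = _ := by push_cast; ring

theorem norm_map_duhamelMap_splitting_sub_le_div [CompleteSpace H] (ι : H →L[ℂ] F)
    (hU : IsUnitaryGroupGeneratedBy A U) (hιU : ∀ t x, ‖ι (U t x)‖ = ‖ι x‖) {C K R Λ : ℝ≥0}
    (hC : ∀ x, LipschitzWith (C * ‖x‖₊) fun t => ι (U t x)) {τ Mα Mβ : ℝ} (hτ : 0 < τ)
    (hα : IsSplittingProfile τ α) (hβ : IsSplittingProfile τ β)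
    (hMα : ∀ t, |α t| ≤ Mα) (hMβ : ∀ t, |β t| ≤ Mβ) (hg : ContinuousOn g (Icc 0 T))
    (hιg : LipschitzOnWith Λ (ι ∘ g) (Icc 0 T)) (hK : ∀ s ∈ Icc 0 T, ‖g s‖ ≤ K)
    (hR : ∀ s ∈ Icc 0 T, ‖interactionPicture U (fun _ => 1) (fun _ => 1) u₀ g s‖ ≤ R)
    {n : ℕ} (hn : 0 < n) (ht : t ∈ Icc 0 T) :
    ‖ι (duhamelMap U (fun s => α (n * s)) (fun s => β (n * s)) u₀ g t) -
      ι (duhamelMap U (fun _ => 1) (fun _ => 1) u₀ g t)‖ ≤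
      (1 + Mβ * T + (Mβ + 1) * (T + 1)) *
        ((C * (R + K) * (Mα + 1) + C * K + Λ + ‖ι‖ * K) * (τ / n)) := by
  have hMα0 : 0 ≤ Mα := (abs_nonneg _).trans (hMα 0)
  have hsource := lipschitzOnWith_map_unitary_apply ι hιU hC (LipschitzWith.id.neg) hιg hK
  have hpropagator {x : H} {S : ℝ≥0} (hx : ‖x‖ ≤ S) {r t : ℝ}
      (hr : |r - t| ≤ (Mα + 1) * τ / n) : ‖ι (U r x) - ι (U t x)‖ ≤ C * S * (Mα + 1) * (τ / n) := by
    rw [← dist_eq_norm, mul_assoc _ (Mα + 1), ← mul_div_assoc]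
    refine ((hC x).dist_le_mul r t).trans ?_
    push_cast
    rw [Real.dist_eq]
    gcongr
  have hC' : 0 ≤ C * R * (Mα + 1) ∧ 0 ≤ C * K * (Mα + 1) := ⟨by positivity, by positivity⟩
  have hC'' : 0 ≤ (C * K + Λ : ℝ) ∧ 0 ≤ ‖ι‖ * K := ⟨by positivity, by positivity⟩
  have hle {x c : ℝ} (hx : x ≤ c * (τ / n))
      (hc : c ≤ C * R * (Mα + 1) + C * K * (Mα + 1) + (C * K + Λ) + ‖ι‖ * K) :
      x ≤ (C * (R + K) * (Mα + 1) + C * K + Λ + ‖ι‖ * K) * (τ / n) :=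
    hx.trans (mul_le_mul_of_nonneg_right (hc.trans_eq (by ring)) (by positivity))
  refine norm_map_duhamelMap_splitting_sub_le ι hU hιU hτ hα hβ hMα hMβ hn hg
    (fun s hs => (ι.le_opNorm _).trans (mul_le_mul_of_nonneg_left (hK s hs) (norm_nonneg ι)))
    (hle (mul_comm _ _).le (by linarith))
    (fun t ht r hr => hle (hpropagator (hR t ht) hr) (by linarith))
    (fun s hs r hr => hle (hpropagator (hK s hs) ?_) (by linarith))
    (fun r hr s hs hrs hsr => hle ?_ (show (C * K + Λ : ℝ) ≤ _ by linarith)) ht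
  · rwa [neg_sub_neg, abs_sub_comm]
  · rw [← dist_eq_norm]
    refine (hsource.dist_le_mul s hs r hr).trans ?_
    rw [Real.dist_eq, abs_of_nonneg (sub_nonneg.2 hrs), mul_one]
    push_cast
    gcongr
    linarith

theorem exists_norm_map_duhamelMap_splitting_sub_le_div [CompleteSpace H] (ι : H →L[ℂ] F)
    (hU : IsUnitaryGroupGeneratedBy A U) (hιU : ∀ t x, ‖ι (U t x)‖ = ‖ι x‖) {C : ℝ≥0}
    (hC : ∀ x, LipschitzWith (C * ‖x‖₊) fun t => ι (U t x)) {τ : ℝ} (hτ : 0 < τ)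
    (hα : IsSplittingProfile τ α) (hβ : IsSplittingProfile τ β) (hT : 0 ≤ T)
    (hg : ContinuousOn g (Icc 0 T)) {Λ : ℝ≥0} (hιg : LipschitzOnWith Λ (ι ∘ g) (Icc 0 T)) :
    ∃ D ≥ 0, ∀ n : ℕ, 0 < n → ∀ t ∈ Icc 0 T,
      ‖ι (duhamelMap U (fun s => α (n * s)) (fun s => β (n * s)) u₀ g t) -
        ι (duhamelMap U (fun _ => 1) (fun _ => 1) u₀ g t)‖ ≤ D / n := by
  obtain ⟨Mα, hMα⟩ := hα.bounded
  obtain ⟨Mβ, hMβ⟩ := hβ.bounded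
  have hMα0 : 0 ≤ Mα := (abs_nonneg _).trans (hMα 0)
  have hMβ0 : 0 ≤ Mβ := (abs_nonneg _).trans (hMβ 0)
  have hone (s t : ℝ) : IntervalIntegrable (fun _ : ℝ => (1 : ℝ)) volume s t :=
    intervalIntegrable_const
  have h0 : (0 : ℝ) ∈ Icc 0 T := left_mem_Icc.2 hT
  obtain ⟨K, hK⟩ := isCompact_Icc.exists_bound_of_continuousOn hg
  lift K to ℝ≥0 using (norm_nonneg _).trans (hK 0 h0)
  obtain ⟨R, hR⟩ := isCompact_Icc.exists_bound_of_continuousOn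
    (continuousOn_interactionPicture (u₀ := u₀) hU hone hone hT hg)
  lift R to ℝ≥0 using (norm_nonneg _).trans (hR 0 h0)
  refine ⟨(1 + Mβ * T + (Mβ + 1) * (T + 1)) *
    ((C * (R + K) * (Mα + 1) + C * K + Λ + ‖ι‖ * K) * τ), by positivity, fun n hn t ht => ?_⟩
  rw [mul_div_assoc, mul_div_assoc]
  exact norm_map_duhamelMap_splitting_sub_le_div ι hU hιU hC hτ hα hβ hMα hMβ hg hιg hK hR hn ht

end Consistency

/-! ### Convergence of the splitting -/

section Convergence

variable {H F : Type*} [NormedAddCommGroup H] [InnerProductSpace ℂ H] [CompleteSpace H]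
  [NormedAddCommGroup F] [NormedSpace ℂ F] {A : H →ₗ.[ℂ] H} {U : ℝ → H →L[ℂ] H} {B : H → H}
  {τ : ℝ} {α β : ℝ → ℝ} {u₀ : H} {T : ℝ} {u : ℝ → H}

theorem eventually_exists_mem_pathTube_eqOn_duhamelMap (hU : IsUnitaryGroupGeneratedBy A U)
    (hB : LocallyLipschitz B) (hτ : 0 < τ) (hα : IsSplittingProfile τ α)
    (hβ : IsSplittingProfile τ β) (hT : 0 ≤ T) (hu : ContinuousOn u (Icc 0 T))
    (heq : EqOn u (duhamelMap U (fun _ => 1) (fun _ => 1) u₀ (B ∘ u)) (Icc 0 T))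
    {δ : ℝ} (hδ : 0 < δ) :
    ∀ᶠ n : ℕ in atTop, ∃ v ∈ pathTube u T δ,
      EqOn v (duhamelMap U (fun s => α (n * s)) (fun s => β (n * s)) u₀ (B ∘ v)) (Icc 0 T) := by
  obtain ⟨M, hM⟩ := hβ.bounded
  have hM0 : 0 ≤ M := (abs_nonneg _).trans (hM 0)
  obtain ⟨ρ, hρ, L, hL, hBL⟩ := (locallyLipschitzAlong_id hB).exists_lipschitz_near_isCompact
    (isCompact_Icc.image_of_continuousOn hu)
  set K : ℝ := (M + 1) * L
  set η : ℝ := min δ ρ / (2 * Real.exp (2 * K * T)) with hη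
  have hηeq : Real.exp (2 * K * T) * (2 * η) = min δ ρ := by
    rw [hη]
    field_simp
  have hη0 : 0 < η := div_pos (lt_min hδ hρ) (by positivity)
  filter_upwards [eventually_gt_atTop 0, Metric.tendstoUniformlyOn_iff.1
    (tendstoUniformlyOn_duhamelMap_splitting (u₀ := u₀) hU hτ hα hβ hT
      (hB.continuous.comp_continuousOn hu)) η hη0] with n hn hclose
  have hvolterra : IsVolterraOn (fun v => duhamelMap U (fun s => α (n * s)) (fun s => β (n * s))
      u₀ (B ∘ v)) T K (pathTube u T (min δ ρ)) :=
    isVolterraOn_duhamelMap hU (hα.intervalIntegrable_comp_mul hn)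
      (hβ.intervalIntegrable_comp_mul hn) (fun s => (hM _).trans (lt_add_one M).le) hT
      hB.continuous (fun v hv => hv.1) fun v hv w hw t ht =>
        hBL _ (mem_image_of_mem u ht) _ _ ((hv.2 t ht).trans (min_le_right _ _))
          ((hw.2 t ht).trans (min_le_right _ _))
  obtain ⟨v, hv, hveq⟩ := (hηeq ▸ hvolterra).exists_fixedPoint (η := η) (by positivity) hT hu
    fun t ht => by
      rw [heq ht, ← dist_eq_norm, dist_comm]
      exact (hclose t ht).le
  exact ⟨v, pathTube_mono (hηeq.trans_le (min_le_left _ _)) hv, hveq⟩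

theorem exists_norm_map_sub_le_div_of_mem_pathTube (ι : H →L[ℂ] F)
    (hU : IsUnitaryGroupGeneratedBy A U) (hιU : ∀ t x, ‖ι (U t x)‖ = ‖ι x‖) {C : ℝ≥0}
    (hC : ∀ x, LipschitzWith (C * ‖x‖₊) fun t => ι (U t x)) (hB : Continuous B)
    (hιB : LocallyLipschitzAlong ι B) (hτ : 0 < τ) (hα : IsSplittingProfile τ α)
    (hβ : IsSplittingProfile τ β) (hT : 0 ≤ T) (hu : ContinuousOn u (Icc 0 T))
    (heq : EqOn u (duhamelMap U (fun _ => 1) (fun _ => 1) u₀ (B ∘ u)) (Icc 0 T)) :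
    ∃ δ > 0, ∃ D ≥ 0, ∀ n : ℕ, 0 < n → ∀ v ∈ pathTube u T δ,
      EqOn v (duhamelMap U (fun s => α (n * s)) (fun s => β (n * s)) u₀ (B ∘ v)) (Icc 0 T) →
      ∀ t ∈ Icc 0 T, ‖ι (v t) - ι (u t)‖ ≤ D / n := by
  obtain ⟨M, hM⟩ := hβ.bounded
  have hM0 : 0 ≤ M := (abs_nonneg _).trans (hM 0)
  have hBu := hB.comp_continuousOn hu
  obtain ⟨δ, hδ, L, hL, hBL⟩ :=
    hιB.exists_lipschitz_near_isCompact (isCompact_Icc.image_of_continuousOn hu)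
  obtain ⟨Λ, hΛ⟩ := exists_lipschitzOnWith_map_duhamelMap_one (u₀ := u₀) ι hU hιU hC hT hBu
  have hιu : LipschitzOnWith Λ (ι ∘ u) (Icc 0 T) := fun s hs t ht => by
    rw [Function.comp_apply, Function.comp_apply, heq hs, heq ht]
    exact hΛ hs ht
  obtain ⟨Λ', hΛ'⟩ := hιB.exists_lipschitzOnWith_map_comp isCompact_Icc hu hιu
  obtain ⟨D, hD, hconsistency⟩ := exists_norm_map_duhamelMap_splitting_sub_le_div (u₀ := u₀) ι hU
    hιU hC hτ hα hβ hT hBu hΛ'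
  refine ⟨δ, hδ, D * Real.exp (M * L * T), by positivity, fun n hn v hv hveq t ht => ?_⟩
  have hdist : ContinuousOn (fun t => ‖ι (v t) - ι (u t)‖) (Icc 0 T) :=
    ((ι.continuous.comp_continuousOn hv.1).sub (ι.continuous.comp_continuousOn hu)).norm
  have hstability (t : ℝ) (ht : t ∈ Icc 0 T) : ‖ι (v t) - ι (u t)‖ ≤
      D / n + M * L * ∫ s in (0 : ℝ)..t, ‖ι (v s) - ι (u s)‖ := by
    rw [mul_assoc, ← intervalIntegral.integral_const_mul, add_comm]
    nth_rewrite 1 [hveq ht, heq ht]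
    refine (norm_sub_le_norm_sub_add_norm_sub _ _ _).trans (add_le_add
      (norm_map_duhamelMap_sub_le ι hU hιU (hα.intervalIntegrable_comp_mul hn)
        (hβ.intervalIntegrable_comp_mul hn) (fun s => hM _) (hB.comp_continuousOn hv.1) hBu
        (continuousOn_const.mul hdist) (fun s hs => ?_) ht) (hconsistency n hn t ht))
    exact hBL _ (mem_image_of_mem u hs) _ _ (hv.2 s hs) (by simpa using hδ.le)
  rw [mul_div_right_comm]
  refine (le_mul_exp_of_le_add_integral (by positivity) hdist hstability t ht).trans ?_
  gcongr
  exact ht.2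

theorem IsMildSolutionOn.exists_eventually_splitting (ι : H →L[ℂ] F)
    (hU : IsUnitaryGroupGeneratedBy A (unitaryGroup A))
    (hιU : ∀ t x, ‖ι (unitaryGroup A t x)‖ = ‖ι x‖) {C : ℝ≥0}
    (hC : ∀ x, LipschitzWith (C * ‖x‖₊) fun t => ι (unitaryGroup A t x))
    (hB : LocallyLipschitz B) (hιB : LocallyLipschitzAlong ι B) (hτ : 0 < τ)
    (hα : IsSplittingProfile τ α) (hβ : IsSplittingProfile τ β) (hT : 0 ≤ T)
    (hu : IsMildSolutionOn A B (fun _ => 1) (fun _ => 1) u₀ T u) :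
    ∃ D ≥ 0, ∀ δ > 0, ∀ᶠ n : ℕ in atTop, ∃ v,
      IsMildSolutionOn A B (fun s => α (n * s)) (fun s => β (n * s)) u₀ T v ∧
      ∀ t ∈ Icc 0 T, ‖v t - u t‖ ≤ δ ∧ ‖ι (v t) - ι (u t)‖ ≤ D / n := by
  have hone (s t : ℝ) : IntervalIntegrable (fun _ : ℝ => (1 : ℝ)) volume s t :=
    intervalIntegrable_const
  obtain ⟨huc, heq⟩ := (isMildSolutionOn_iff hU hone hone hB.continuous).1 hu
  obtain ⟨ρ, hρ, D, hD, hrate⟩ := exists_norm_map_sub_le_div_of_mem_pathTube ι hU hιU hC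
    hB.continuous hιB hτ hα hβ hT huc heq
  refine ⟨D, hD, fun δ hδ => ?_⟩
  filter_upwards [eventually_gt_atTop 0, eventually_exists_mem_pathTube_eqOn_duhamelMap hU hB hτ
    hα hβ hT huc heq (lt_min hδ hρ)] with n hn hex
  obtain ⟨v, hv, hveq⟩ := hex
  refine ⟨v, (isMildSolutionOn_iff hU (hα.intervalIntegrable_comp_mul hn)
    (hβ.intervalIntegrable_comp_mul hn) hB.continuous).2 ⟨hv.1, hveq⟩, fun t ht =>
    ⟨(hv.2 t ht).trans (min_le_left _ _),
      hrate n hn v (pathTube_mono (min_le_right _ _) hv) hveq t ht⟩⟩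

end Convergence

/-! ### The interpolation inequality -/

section Interpolation

/-- The multiplier of the three lines theorem: `z ↦ e^{(z - θ) l}` rescales the two boundary lines
against each other, and the factor `e^{z² - θ²}` makes it vanish at infinity. It equals one at
`θ`. -/
def threeLinesMultiplier (θ l : ℝ) (z : ℂ) : ℂ :=
  Complex.exp (z ^ 2 - θ ^ 2 + (z - θ) * l)

theorem differentiable_threeLinesMultiplier (θ l : ℝ) :
    Differentiable ℂ (threeLinesMultiplier θ l) := by
  unfold threeLinesMultiplier
  fun_prop

theorem norm_threeLinesMultiplier (θ l : ℝ) (z : ℂ) :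
    ‖threeLinesMultiplier θ l z‖ =
      Real.exp (z.re ^ 2 - θ ^ 2 + (z.re - θ) * l) * Real.exp (-z.im ^ 2) := by
  rw [threeLinesMultiplier, Complex.norm_exp, ← Real.exp_add]
  congr 1
  simp only [sq, Complex.add_re, Complex.sub_re, Complex.mul_re, Complex.ofReal_re,
    Complex.ofReal_im, Complex.sub_im]
  ring

theorem norm_threeLinesMultiplier_le (θ l : ℝ) (z : ℂ) :
    ‖threeLinesMultiplier θ l z‖ ≤ Real.exp (z.re ^ 2 + (z.re - θ) * l) := by
  rw [norm_threeLinesMultiplier, ← Real.exp_add, Real.exp_le_exp]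
  linarith [sq_nonneg θ, sq_nonneg z.im]

theorem tendsto_threeLinesMultiplier_cocompact (θ l a : ℝ) :
    Tendsto (fun t : ℝ => threeLinesMultiplier θ l (a + t * Complex.I)) (cocompact ℝ) (𝓝 0) := by
  have hsq : Tendsto (fun t : ℝ => t ^ 2) (cocompact ℝ) atTop := by
    simpa [Function.comp_def] using
      (tendsto_pow_atTop two_ne_zero).comp (tendsto_norm_cocompact_atTop (E := ℝ))
  rw [tendsto_zero_iff_norm_tendsto_zero]
  simp only [norm_threeLinesMultiplier]
  simpa using (Real.tendsto_exp_neg_atTop_nhds_zero.comp hsq).const_mul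
    (Real.exp (a ^ 2 - θ ^ 2 + (a - θ) * l))

variable {H₀ H₁ : Type*} [NormedAddCommGroup H₀] [InnerProductSpace ℂ H₀]
  [NormedAddCommGroup H₁] [InnerProductSpace ℂ H₁] (ι : H₁ →L[ℂ] H₀) {θ l M : ℝ} {x : H₁}

theorem isCalderonFunction_threeLinesMultiplier_smul (h₀ : Real.exp (-θ * l) * ‖ι x‖ ≤ M)
    (h₁ : Real.exp (1 + (1 - θ) * l) * ‖x‖ ≤ M) :
    IsCalderonFunction ι (fun z => threeLinesMultiplier θ l z • ι x)
      (fun t => threeLinesMultiplier θ l (1 + t * Complex.I) • x) M where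
  continuousOn :=
    ((differentiable_threeLinesMultiplier θ l).continuous.smul continuous_const).continuousOn
  bounded := by
    refine ⟨Real.exp (1 + (1 + |θ|) * |l|) * ‖ι x‖, fun z hz0 hz1 => ?_⟩
    rw [norm_smul]
    gcongr
    refine (norm_threeLinesMultiplier_le θ l z).trans (Real.exp_le_exp.2 (add_le_add ?_ ?_))
    · exact pow_le_one₀ hz0 hz1
    · refine (le_abs_self _).trans ((abs_mul _ _).trans_le ?_)
      gcongr
      exact (abs_sub _ _).trans (by rw [abs_of_nonneg hz0]; gcongr)
  holomorphic := ((differentiable_threeLinesMultiplier θ l).smul_const _).differentiableOn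
  boundary_one t := (map_smul ι _ _).symm
  continuous_one := ((differentiable_threeLinesMultiplier θ l).continuous.comp
    (by fun_prop)).smul continuous_const
  tendsto_zero := by
    simpa using (tendsto_threeLinesMultiplier_cocompact θ l 0).smul_const (ι x)
  tendsto_one := by
    simpa using (tendsto_threeLinesMultiplier_cocompact θ l 1).smul_const x
  norm_zero_le t := by
    rw [norm_smul]
    refine (mul_le_mul_of_nonneg_right (norm_threeLinesMultiplier_le θ l _)
      (norm_nonneg _)).trans ?_
    simpa using h₀
  norm_one_le t := by
    rw [norm_smul]
    refine (mul_le_mul_of_nonneg_right (norm_threeLinesMultiplier_le θ l _)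
      (norm_nonneg _)).trans ?_
    simpa using h₁

theorem interpolationENorm_map_le_of_exp_mul_le (h₀ : Real.exp (-θ * l) * ‖ι x‖ ≤ M)
    (h₁ : Real.exp (1 + (1 - θ) * l) * ‖x‖ ≤ M) :
    interpolationENorm ι θ (ι x) ≤ ENNReal.ofReal M := by
  have hcalderon := isCalderonFunction_threeLinesMultiplier_smul ι h₀ h₁
  rw [← Real.coe_toNNReal M (h₀.trans' (by positivity))] at hcalderon
  exact iInf₂_le_of_le M.toNNReal ⟨_, _, hcalderon, by simp [threeLinesMultiplier]⟩ le_rfl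

theorem interpolationENorm_map_le (θ : ℝ) (x : H₁) :
    interpolationENorm ι θ (ι x) ≤
      ENNReal.ofReal (Real.exp 1 * (‖ι x‖ ^ (1 - θ) * ‖x‖ ^ θ)) := by
  rcases eq_or_ne (ι x) 0 with h | h
  · rw [h, ← map_zero ι]
    exact (interpolationENorm_map_le_of_exp_mul_le ι (l := 0) (M := 0) (by simp) (by simp)).trans
      (by simp)
  have hιx : 0 < ‖ι x‖ := norm_pos_iff.2 h
  have hx : 0 < ‖x‖ := norm_pos_iff.2 fun hx => h (by rw [hx, map_zero])
  -- This choice of `l` balances the suprema over the two boundary lines.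
  refine interpolationENorm_map_le_of_exp_mul_le ι (l := Real.log (‖ι x‖ / ‖x‖)) ?_ ?_
  · rw [mul_comm (-θ), ← Real.rpow_def_of_pos (div_pos hιx hx), Real.div_rpow hιx.le hx.le,
      Real.rpow_neg hιx.le, Real.rpow_neg hx.le, Real.rpow_sub hιx, Real.rpow_one, div_inv_eq_mul]
    calc _ = 1 * (‖ι x‖ / ‖ι x‖ ^ θ * ‖x‖ ^ θ) := by ring
      _ ≤ _ := by gcongr; exact Real.one_le_exp zero_le_one
  · rw [Real.exp_add, mul_comm (1 - θ), ← Real.rpow_def_of_pos (div_pos hιx hx),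
      Real.div_rpow hιx.le hx.le, Real.rpow_sub hx, Real.rpow_one]
    exact le_of_eq (by field_simp)

end Interpolation

/-! ### The splitting error in interpolation spaces -/

section Splitting

variable {H₀ H₁ : Type*} [NormedAddCommGroup H₀] [InnerProductSpace ℂ H₀]
  [NormedAddCommGroup H₁] [InnerProductSpace ℂ H₁] {ι : H₁ →L[ℂ] H₀} {A : H₁ →ₗ.[ℂ] H₁}
  {B : H₁ → H₁} {α β : ℝ → ℝ} {u₀ : H₁} {T : ℝ}

theorem isSymmetricExtension_of_isSelfAdjoint [CompleteSpace H₀] {A₀ : H₀ →ₗ.[ℂ] H₀}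
    (hA₀ : IsSelfAdjoint A₀) (hdom : ∀ x : H₁, ι x ∈ A₀.domain)
    (hext : ∀ x : A.domain, A₀ ⟨ι (x : H₁), hdom x⟩ = ι (A x)) :
    IsSymmetricExtension ι A fun x => A₀ ⟨ι x, hdom x⟩ where
  symmetric x y := isFormalAdjoint_of_isSelfAdjoint hA₀ ⟨ι x, hdom x⟩ ⟨ι y, hdom y⟩
  apply_eq x y hxy := by
    obtain ⟨x', rfl, rfl⟩ := (LinearPMap.mem_graph_iff A).1 hxy
    exact hext x'

theorem IsUniformH0Derivative.locallyLipschitzAlong {B' : H₁ → H₀ →L[ℝ] H₀}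
    (hB' : IsUniformH0Derivative ι B B') : LocallyLipschitzAlong ι B := by
  intro p
  obtain ⟨C, -, δ, hδ, hderiv⟩ := hB' (‖p‖ + 1) (by positivity) 1 one_pos
  refine ⟨1 + C, Metric.ball p (min 1 (δ / 2)), Metric.ball_mem_nhds _ (by positivity),
    fun x hx y hy => ?_⟩
  have hy1 : ‖y‖ ≤ ‖p‖ + 1 :=
    norm_le_norm_add_norm_sub' y p |>.trans (by
      gcongr; exact (mem_ball_iff_norm.1 hy).le.trans (min_le_left _ _))
  have hxy : ‖x - y‖ < δ := by
    rw [← dist_eq_norm]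
    have hx2 := (Metric.mem_ball.1 hx).trans_le (min_le_right _ _)
    have hy2 := (Metric.mem_ball.1 hy).trans_le (min_le_right _ _)
    linarith [dist_triangle_right x y p]
  obtain ⟨hC, hle⟩ := hderiv y (x - y) hy1 hxy
  rw [add_sub_cancel, map_sub] at hle
  calc ‖ι (B x) - ι (B y)‖
      ≤ ‖ι (B x) - ι (B y) - B' y (ι x - ι y)‖ + ‖B' y (ι x - ι y)‖ := norm_le_norm_sub_add _ _
    _ ≤ 1 * ‖ι x - ι y‖ + C * ‖ι x - ι y‖ :=
        add_le_add hle ((B' y).le_of_opNorm_le hC _)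
    _ = _ := by ring

theorem exists_isMildSolutionOn_of_lt_existenceTime
    (hT : ENNReal.ofReal T < existenceTime A B α β u₀) :
    ∃ T' : ℝ≥0, ENNReal.ofReal T < T' ∧ ∃ u, IsMildSolutionOn A B α β u₀ T' u := by
  obtain ⟨T', hT'⟩ := lt_iSup_iff.1 hT
  obtain ⟨hu, hlt⟩ := lt_iSup_iff.1 hT'
  exact ⟨T', hlt, hu⟩

theorem IsMildSolutionOn.eventually_interpolationENorm_splitting_sub_le [CompleteSpace H₁]
    (hA : IsSelfAdjoint A) {D : H₁ → H₀} (hD : IsSymmetricExtension ι A D)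
    (hB : LocallyLipschitz B) (hιB : LocallyLipschitzAlong ι B) {τ : ℝ} (hτ : 0 < τ)
    (hα : IsSplittingProfile τ α) (hβ : IsSplittingProfile τ β) {θ : ℝ}
    (hθ : θ ∈ Ioc (0 : ℝ) 1) (hT : 0 ≤ T) {u : ℝ → H₁}
    (hu : IsMildSolutionOn A B (fun _ => 1) (fun _ => 1) u₀ T u) {ε : ℝ} (hε : 0 < ε) :
    ∀ᶠ n : ℕ in atTop, ∃ v,
      IsMildSolutionOn A B (fun s => α (n * s)) (fun s => β (n * s)) u₀ T v ∧
      ∀ t ∈ Icc 0 T, interpolationENorm ι θ (ι (u t - v t)) ≤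
        ENNReal.ofReal (ε / (n : ℝ) ^ (1 - θ)) := by
  have hU := isUnitaryGroupGeneratedBy_unitaryGroup hA
  have hdense := hA.dense_domain
  obtain ⟨C, hC⟩ := hD.exists_lipschitzWith_map_unitary hdense hU
  obtain ⟨E, hE, hsplitting⟩ := hu.exists_eventually_splitting ι hU
    (hD.norm_map_unitary_apply hdense hU) hC hB hιB hτ hα hβ hT
  obtain ⟨c, hc, hcε⟩ := exists_pos_mul_lt hε (Real.exp 1 * E ^ (1 - θ))
  filter_upwards [hsplitting (c ^ θ⁻¹) (by positivity)] with n hn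
  obtain ⟨v, hv, hvu⟩ := hn
  refine ⟨v, hv, fun t ht => (interpolationENorm_map_le ι θ _).trans
    (ENNReal.ofReal_le_ofReal ?_)⟩
  have hθ' := sub_nonneg.2 hθ.2
  calc Real.exp 1 * (‖ι (u t - v t)‖ ^ (1 - θ) * ‖u t - v t‖ ^ θ)
      ≤ Real.exp 1 * ((E / n) ^ (1 - θ) * (c ^ θ⁻¹) ^ θ) := by
        have hθ0 := hθ.1.le
        rw [map_sub, norm_sub_rev, norm_sub_rev (u t)]
        gcongr
        exacts [(hvu t ht).2, (hvu t ht).1]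
    _ = Real.exp 1 * E ^ (1 - θ) * c / (n : ℝ) ^ (1 - θ) := by
        rw [Real.rpow_inv_rpow hc.le hθ.1.ne', Real.div_rpow hE n.cast_nonneg]
        ring
    _ ≤ ε / (n : ℝ) ^ (1 - θ) := by gcongr

end Splitting

theorem mainTheorem6_general {H₀ H₁ : Type*}
    [NormedAddCommGroup H₀] [InnerProductSpace ℂ H₀]
    [NormedAddCommGroup H₁] [InnerProductSpace ℂ H₁] [CompleteSpace H₁]
    (ι : H₁ →L[ℂ] H₀) (A : H₁ →ₗ.[ℂ] H₁) (hA : IsSelfAdjoint A)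
    (D : H₁ → H₀) (hD : IsSymmetricExtension ι A D)
    (B : H₁ → H₁) (hB : LocallyLipschitz B) (hιB : LocallyLipschitzAlong ι B)
    (τ : ℝ) (hτ : 0 < τ) (α β : ℝ → ℝ)
    (hα : IsSplittingProfile τ α) (hβ : IsSplittingProfile τ β)
    (θ : ℝ) (hθ : θ ∈ Ioc (0 : ℝ) 1)
    (u₀ : H₁) (T : ℝ) (hT : 0 < T) (hTmax : ENNReal.ofReal T < exactExistenceTime A B u₀)
    (ε : ℝ) (hε : 0 < ε) :
    ∃ n₀ : ℕ, ∀ n : ℕ, n₀ ≤ n →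
      ENNReal.ofReal T < splittingExistenceTime A B α β n u₀ ∧
      ∀ k : ℕ, k ≤ n →
        interpolationENorm ι θ
          (ι (exactFlow A B (k * (T / n)) u₀ - splittingFlow A B α β n (k * (T / n)) u₀)) ≤
          ENNReal.ofReal (ε * (T / n) ^ (1 - θ)) := by
  have hU := isUnitaryGroupGeneratedBy_unitaryGroup hA
  obtain ⟨M, hM⟩ := hβ.bounded
  obtain ⟨T', hTT', u, hu⟩ := exists_isMildSolutionOn_of_lt_existenceTime hTmax
  obtain ⟨n₀, hn₀⟩ := eventually_atTop.1 ((eventually_gt_atTop 0).and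
    (hu.eventually_interpolationENorm_splitting_sub_le hA hD hB hιB hτ hα hβ hθ T'.coe_nonneg
      (ε := ε * T ^ (1 - θ)) (by positivity)))
  refine ⟨n₀, fun n hn => ?_⟩
  obtain ⟨hnpos, v, hv, hle⟩ := hn₀ n hn
  refine ⟨hTT'.trans_le hv.le_existenceTime, fun k hk => ?_⟩
  have hkT : k * (T / n) ≤ T := by
    rw [mul_div_left_comm]
    exact mul_le_of_le_one_right hT.le (div_le_one_of_le₀ (by exact_mod_cast hk) n.cast_nonneg)
  have ht : k * (T / n) ∈ Icc 0 (T' : ℝ) :=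
    ⟨by positivity, hkT.trans (ENNReal.ofReal_le_coe.1 hTT'.le)⟩
  rw [exactFlow, splittingFlow, hu.flow_eq hU (fun _ _ => intervalIntegrable_const)
      (fun _ _ => intervalIntegrable_const) (M := 1) (by simp) hB ht,
    hv.flow_eq hU (hα.intervalIntegrable_comp_mul hnpos) (hβ.intervalIntegrable_comp_mul hnpos)
      (fun _ => hM _) hB ht, Real.div_rpow hT.le n.cast_nonneg]
  exact (hle _ ht).trans_eq (by rw [mul_div_assoc])

end

theorem mainTheorem6 {H₀ H₁ : Type*}
    [NormedAddCommGroup H₀] [InnerProductSpace ℂ H₀] [CompleteSpace H₀]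
    [NormedAddCommGroup H₁] [InnerProductSpace ℂ H₁] [CompleteSpace H₁]
    (ι : H₁ →L[ℂ] H₀) (hι : Function.Injective ι)
    (A : H₁ →ₗ.[ℂ] H₁) (hA : IsSelfAdjoint A)
    (A₀ : H₀ →ₗ.[ℂ] H₀) (hA₀ : IsSelfAdjoint A₀)
    (hdom : ∀ x : H₁, ι x ∈ A₀.domain)
    (hext : ∀ x : A.domain, A₀ ⟨ι (x : H₁), hdom x⟩ = ι (A x))
    (B : H₁ → H₁) (hB : LocallyLipschitz B)
    (B' : H₁ → H₀ →L[ℝ] H₀) (hB' : IsUniformH0Derivative ι B B')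
    (τ : ℝ) (hτ : 0 < τ) (α β : ℝ → ℝ)
    (hα : IsSplittingProfile τ α) (hβ : IsSplittingProfile τ β)
    (θ : ℝ) (hθ : θ ∈ Ioo (0 : ℝ) 1)
    (u₀ : H₁) (T : ℝ) (hT : 0 < T) (hTmax : ENNReal.ofReal T < exactExistenceTime A B u₀)
    (ε : ℝ) (hε : 0 < ε) :
    ∃ n₀ : ℕ, ∀ n : ℕ, n₀ ≤ n →
      ENNReal.ofReal T < splittingExistenceTime A B α β n u₀ ∧
      ∀ k : ℕ, k ≤ n →
        interpolationENorm ι θ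
          (ι (exactFlow A B (k * (T / n)) u₀ - splittingFlow A B α β n (k * (T / n)) u₀)) ≤
          ENNReal.ofReal (ε * (T / n) ^ (1 - θ)) :=
  mainTheorem6_general ι A hA _ (isSymmetricExtension_of_isSelfAdjoint hA₀ hdom hext) B hB
    hB'.locallyLipschitzAlong τ hτ α β hα hβ θ ⟨hθ.1, hθ.2.le⟩ u₀ T hT hTmax ε hε
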